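/- Let $k$ be a field, let $K/k$ be a separable field extension of degree $6$, let $\widetilde K/k$ be its Galois closure, and put $G=\mathrm{Gal}(\widetilde K/k)$, $G'=\mathrm{Gal}(\widetilde K/K)$. Assume that $G\simeq 2S_4$, that is, $G\simeq C_2\times S_4$, where $C_2$ is the group of order $2$. A Hopf Galois structure on a finite extension $F/k$ is a finite cocommutative $k$-Hopf algebra $H$ with an action that makes $F$ an $H$-module algebra and for which the $k$-linear map $F\otimes_k H\to\mathrm{End}_k(F)$, $s\otimes h\mapsto (t\mapsto s\,(h t))$, is bijective; two structures are identified if there is an isomorphism of Hopf algebras between them compatible with the actions on $F$. The extension $F/k$ is Hopf Galois if it has a Hopf Galois structure. For a field $F$ with $K\subset F\subset\widetilde K$, put $G_F=\mathrm{Gal}(\widetilde K/F)$ and let $\lambda:G\to\mathrm{Sym}(G/G_F)$ be the action on left cosets by left translation; $F/k$ is almost classically Galois if there is a regular (simply transitive) subgroup $N$ of $\mathrm{Sym}(G/G_F)$ that is normalized by $\lambda(G)$ and contained in $\lambda(G)$. Then the following hold for fields $F$ with $K\subset F\subset\widetilde K$. 1. If $[F:k]=12$, then $F/k$ is not Hopf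 Galois. 2. There exists such an $F$ with $[F:k]=24$ and $F/k$ almost classically Galois. More precisely, $G'$ has exactly one normal subgroup $C$ of order $2$, and every such $F$ with $[F:k]=24$ and $F\neq\widetilde K^{C}$ is such that $F/k$ is almost classically Galois and has at least two different Hopf Galois structures. -/

import Mathlib

open scoped TensorProduct

universe u v

/-- For a `k`-algebra homomorphism `act : H → End_k(F)` (an `H`-module structure on `F`), the
`k`-linear map `j : F ⊗[k] H → End_k(F)` with `j (s ⊗ h) t = s * (h • t)`. -/
noncomputable def hopfGaloisMap {k : Type u} {F : Type v} [Field k] [Field F] [Algebra k F]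
    {H : Type v} [Ring H] [Algebra k H] (act : H →ₐ[k] Module.End k F) :
    F ⊗[k] H →ₗ[k] Module.End k F :=
  TensorProduct.lift
    ((LinearMap.mul k (Module.End k F)).compl₁₂ (Algebra.lmul k F).toLinearMap act.toLinearMap)

theorem hopfGaloisMap_tmul {k : Type u} {F : Type v} [Field k] [Field F] [Algebra k F]
    {H : Type v} [Ring H] [Algebra k H] (act : H →ₐ[k] Module.End k F) (s : F) (h : H) (t : F) :
    hopfGaloisMap act (s ⊗ₜ[k] h) t = s * act h t := by
  simp [hopfGaloisMap]

/-- A Hopf Galois structure on the field extension `F/k`: a finite cocommutative `k`-Hopf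
algebra `H` together with an action of `H` on `F` that makes `F` an `H`-module algebra and for
which `j : F ⊗[k] H → End_k(F)` is bijective.

As `k` embeds into `F` and `H` is finite over `k`, every such `H` has a copy in the universe
of `F`. -/
structure HopfGaloisStructure (k : Type u) (F : Type v) [Field k] [Field F] [Algebra k F] where
  H : Type v
  [ring : Ring H]
  [hopfAlgebra : HopfAlgebra k H]
  [finite : Module.Finite k H]
  [cocomm : Coalgebra.IsCocomm k H]
  /-- the `H`-module structure on `F`: `act h t` is `h • t` -/
  act : H →ₐ[k] Module.End k F
  /-- `h • 1 = ε(h) 1` -/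
  act_one (h : H) : act h 1 = algebraMap k F (Coalgebra.counit (R := k) h)
  /-- `h • (x y) = ∑ (h₁ • x) (h₂ • y)`, where `Δ(h) = ∑ h₁ ⊗ h₂` -/
  act_mul (h : H) (x y : F) :
    act h (x * y) =
      LinearMap.mul' k F
        (TensorProduct.map (act.toLinearMap.flip x) (act.toLinearMap.flip y)
          (Coalgebra.comul (R := k) h))
  bijective : Function.Bijective (hopfGaloisMap act)

attribute [instance] HopfGaloisStructure.ring HopfGaloisStructure.hopfAlgebra
  HopfGaloisStructure.finite HopfGaloisStructure.cocomm

/-- Two Hopf Galois structures on `F/k` are the same if there is an isomorphism of Hopf algebras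
between them that respects the actions on `F`. (A bialgebra isomorphism between Hopf algebras
commutes with the antipodes.) -/
def HopfGaloisStructure.Equivalent {k : Type u} {F : Type v} [Field k] [Field F] [Algebra k F]
    (S T : HopfGaloisStructure k F) : Prop :=
  ∃ φ : S.H ≃ₐc[k] T.H, ∀ h : S.H, T.act (φ h) = S.act h

/-- `F/k` is a Hopf Galois extension. -/
def IsHopfGalois (k : Type u) (F : Type v) [Field k] [Field F] [Algebra k F] : Prop :=
  Nonempty (HopfGaloisStructure k F)

/-- A group of permutations of `X` is regular if it is simply transitive. -/
def IsRegularPermSubgroup {X : Type*} (N : Subgroup (Equiv.Perm X)) : Prop :=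
  ∀ x y : X, ∃! n : Equiv.Perm X, n ∈ N ∧ n x = y

/-- `λ : G → Sym(G/G')`, the action of `G` on the left cosets of `G'` by left translation. -/
def cosetAction {G : Type*} [Group G] (G' : Subgroup G) : G →* Equiv.Perm (G ⧸ G') :=
  MulAction.toPermHom G (G ⧸ G')

/-- `F/k` is almost classically Galois, where `F` is a subextension of the Galois extension `L/k`:
with `G = Gal(L/k)` and `G' = Gal(L/F)`, some regular subgroup `N` of `Sym(G/G')` is normalized
by `λ(G)` and contained in `λ(G)`. This is used for `L` the Galois closure of `F/k`; the set
`G/G'` and the group `λ(G)` are the same for every Galois extension `L/k` containing `F`. -/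
def IsAlmostClassicallyGalois (k : Type u) {L : Type v} [Field k] [Field L] [Algebra k L]
    (F : IntermediateField k L) : Prop :=
  ∃ N : Subgroup (Equiv.Perm (Gal(L/k) ⧸ F.fixingSubgroup)),
    IsRegularPermSubgroup N ∧
    (∀ g : Gal(L/k), ∀ n ∈ N,
      cosetAction F.fixingSubgroup g * n * (cosetAction F.fixingSubgroup g)⁻¹ ∈ N) ∧
    N ≤ (cosetAction F.fixingSubgroup).range

/-- The group `2S₄`, the direct product of a group of order `2` and `S₄`. -/
abbrev TwoSFour : Type := Multiplicative (ZMod 2) × Equiv.Perm (Fin 4)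

/-- `C` is a normal subgroup of order `2` of the subgroup `G'` of `G`. -/
def IsNormalOrderTwoSubgroup {G : Type*} [Group G] (G' C : Subgroup G) : Prop :=
  C ≤ G' ∧ Nat.card C = 2 ∧ (C.subgroupOf G').Normal

/-! Since `L` is the normal closure of `K`, the group `G'` has order eight and contains no
nontrivial normal subgroup of `G`. Up to automorphisms of `2S₄` there is one such subgroup: the
dihedral group generated by `(1, (0 1 2 3))` and `(ζ, (0 1)(2 3))`, where `ζ` generates the factor
of order two (`exists_equiv_dihedral`). Its centre is generated by `s = (1, (0 2)(1 3))`, called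
`sq`.

Degree 12. A Hopf Galois structure on `F` yields a regular group `N` of permutations of the
embeddings `F → L`, normalized by `G` (the Greither-Pareigis direction,
`exists_regular_normalized`). The stabilizer of a point has order four and contains `s`. If `N` had
a single Sylow 3-subgroup, then `s`, being a commutator, would centralize an element of order three,
which moves every fixed point of `s`; but the fixed points of `s` form one orbit of the 2-group
`C_G(s)`. So `N` acts faithfully on its four Sylow 3-subgroups and has trivial centre. As `48 > 4!`,
some nontrivial element of `G` acts trivially on these four and hence centralizes `N`; it can only
be `ζ`. The same holds for the centralizer of `N`, whose centralizer is `N` again. Hence `ζ` acts as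
a central element of `N`, so trivially, which is absurd (`not_normalized_regular`).

Degree 24. If `F` is the fixed field of a noncentral involution `t` of `G'`, the first coordinate of
`t` is `ζ`, and at least two characters of order two are nontrivial at `t`. Each kernel `N` is a
normal complement of `⟨t⟩`, hence regular on `G/⟨t⟩`, and with `M = L^N` the `t`-invariants of
`M[N]` give a Hopf Galois structure (`hopfGaloisStructure`). Distinct kernels have distinct
quadratic fields `M`, and these can be read off from coefficients of the operators on `F`
(`not_equivalent`). -/

/-! ### Coefficient functions of a Hopf action and their convolution products. -/

namespace GreitherPareigis

open LinearMap

variable {k : Type u} {F : Type v} {L : Type*} [Field k] [Field F] [Field L] [Algebra k F]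
  [Algebra k L] [FiniteDimensional k F]

/-- If `L` splits `F/k`, the embeddings `F → L` form an `L`-basis of `Hom_k(F, L)`. -/
noncomputable def embBasis (hX : Fintype.card (F →ₐ[k] L) = Module.finrank k F) :
    Module.Basis (F →ₐ[k] L) L (F →ₗ[k] L) :=
  haveI : Nonempty (F →ₐ[k] L) := by
    rw [← Fintype.card_pos_iff, hX]; exact Module.finrank_pos
  basisOfLinearIndependentOfCardEqFinrank (linearIndependent_toLinearMap k F L)
    (by rw [hX, Module.finrank_linearMap_self])

theorem embBasis_apply (hX : Fintype.card (F →ₐ[k] L) = Module.finrank k F) (x : F →ₐ[k] L) :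
    embBasis hX x = x.toLinearMap := by
  simp [embBasis]

theorem eq_of_sum_mul_eq {f g : (F →ₐ[k] L) → L}
    (h : ∀ a : F, ∑ y, f y * y a = ∑ y, g y * y a) : f = g := by
  have hli := linearIndependent_toLinearMap k F L
  rw [Fintype.linearIndependent_iff] at hli
  funext y
  refine sub_eq_zero.1 (hli (fun y => f y - g y) ?_ y)
  ext a
  simp [sub_mul, Finset.sum_sub_distrib, h a]

variable (hX : Fintype.card (F →ₐ[k] L) = Module.finrank k F) (S : HopfGaloisStructure k F)

/-- The `y`-coordinate of `h ↦ x ∘ h`. -/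
noncomputable def coeff (x y : F →ₐ[k] L) : S.H →ₗ[k] L where
  toFun h := (embBasis hX).repr (x.toLinearMap ∘ₗ S.act h) y
  map_add' h h' := by simp [LinearMap.comp_add]
  map_smul' c h := by
    have : x.toLinearMap ∘ₗ (c • S.act h) = (algebraMap k L c) • (x.toLinearMap ∘ₗ S.act h) := by
      ext a; simp [Algebra.smul_def]
    rw [map_smul, this, map_smul, Finsupp.smul_apply, smul_eq_mul, RingHom.id_apply,
      Algebra.smul_def]

theorem coeff_spec (x : F →ₐ[k] L) (h : S.H) (a : F) :
    x (S.act h a) = ∑ y, coeff hX S x y h * y a := by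
  have := congr($((embBasis hX).sum_repr (x.toLinearMap ∘ₗ S.act h)) a)
  simp only [LinearMap.coe_sum, Finset.sum_apply, LinearMap.smul_apply, embBasis_apply] at this
  exact this.symm

theorem eq_coeff {x : F →ₐ[k] L} {h : S.H} {f : (F →ₐ[k] L) → L}
    (hf : ∀ a, x (S.act h a) = ∑ y, f y * y a) (y : F →ₐ[k] L) : coeff hX S x y h = f y := by
  refine congr_fun (eq_of_sum_mul_eq (f := fun y => coeff hX S x y h) fun a => ?_) y
  rw [← coeff_spec, hf]

theorem coeff_one [DecidableEq (F →ₐ[k] L)] (x y : F →ₐ[k] L) :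
    coeff hX S x y 1 = if x = y then 1 else 0 :=
  eq_coeff hX S (f := fun y => if x = y then 1 else 0) (by simp) y

theorem coeff_mul (x y : F →ₐ[k] L) (h h' : S.H) :
    coeff hX S x y (h * h') = ∑ z, coeff hX S x z h * coeff hX S z y h' := by
  refine eq_coeff hX S (f := fun y => ∑ z, coeff hX S x z h * coeff hX S z y h') (fun a => ?_) y
  simp only [map_mul, Module.End.mul_apply, coeff_spec hX S _ h, coeff_spec hX S _ h',
    Finset.mul_sum, Finset.sum_mul]
  rw [Finset.sum_comm]
  simp [mul_assoc]

theorem sum_coeff (x : F →ₐ[k] L) (h : S.H) :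
    ∑ y, coeff hX S x y h = algebraMap k L (Coalgebra.counit (R := k) h) := by
  have := coeff_spec hX S x h 1
  simpa [S.act_one] using this.symm

/-- The convolution product of two linear maps `H → L`. -/
noncomputable def conv {H : Type*} [AddCommMonoid H] [Module k H] [Coalgebra k H]
    (f g : H →ₗ[k] L) : H →ₗ[k] L :=
  LinearMap.mul' k L ∘ₗ TensorProduct.map f g ∘ₗ Coalgebra.comul

section conv

variable {H : Type*} [AddCommGroup H] [Module k H] [Coalgebra k H] {ι : Type*}

theorem conv_smul_left (l : L) (f g : H →ₗ[k] L) : conv (l • f) g = l • conv f g := by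
  have : mul' k L ∘ₗ TensorProduct.map (l • f) g = l • (mul' k L ∘ₗ TensorProduct.map f g) := by
    ext a b; simp [mul_assoc]
  rw [conv, ← LinearMap.comp_assoc, this]; rfl

theorem conv_smul_right (l : L) (f g : H →ₗ[k] L) : conv f (l • g) = l • conv f g := by
  have : mul' k L ∘ₗ TensorProduct.map f (l • g) = l • (mul' k L ∘ₗ TensorProduct.map f g) := by
    ext a b; simp [mul_left_comm]
  rw [conv, ← LinearMap.comp_assoc, this]; rfl

theorem conv_sum_left (s : Finset ι) (f : ι → H →ₗ[k] L) (g : H →ₗ[k] L) :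
    conv (∑ i ∈ s, f i) g = ∑ i ∈ s, conv (f i) g := by
  have : mul' k L ∘ₗ TensorProduct.map (∑ i ∈ s, f i) g =
      ∑ i ∈ s, (mul' k L ∘ₗ TensorProduct.map (f i) g) := by
    ext a b; simp [Finset.sum_mul]
  ext h
  have := congr($this (Coalgebra.comul h))
  simpa [conv] using this

theorem conv_sum_right (s : Finset ι) (f : H →ₗ[k] L) (g : ι → H →ₗ[k] L) :
    conv f (∑ i ∈ s, g i) = ∑ i ∈ s, conv f (g i) := by
  have : mul' k L ∘ₗ TensorProduct.map f (∑ i ∈ s, g i) =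
      ∑ i ∈ s, (mul' k L ∘ₗ TensorProduct.map f (g i)) := by
    ext a b; simp [Finset.mul_sum]
  ext h
  have := congr($this (Coalgebra.comul h))
  simpa [conv] using this

theorem conv_counit_left (f : H →ₗ[k] L) :
    conv (Algebra.linearMap k L ∘ₗ Coalgebra.counit) f = f := by
  have : mul' k L ∘ₗ TensorProduct.map (Algebra.linearMap k L ∘ₗ Coalgebra.counit) f =
      (TensorProduct.lift (LinearMap.lsmul k L)) ∘ₗ f.lTensor k ∘ₗ
        (Coalgebra.counit (R := k) (A := H)).rTensor H := by
    ext a b; simp [Algebra.smul_def]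
  rw [conv, ← LinearMap.comp_assoc, this]
  ext h
  rw [LinearMap.comp_apply, LinearMap.comp_apply, LinearMap.comp_apply,
    Coalgebra.rTensor_counit_comul]
  simp

end conv

/-- Expanding `x (h • (a b))` once directly and once through the comultiplication gives two
combinations of the products `y a * z b`; independence of the embeddings, used in `a` and then in
`b`, compares coefficients. The coefficient functions at `x` are thus orthogonal idempotents. -/
theorem conv_coeff [DecidableEq (F →ₐ[k] L)] (x y z : F →ₐ[k] L) :
    conv (coeff hX S x y) (coeff hX S x z) = if y = z then coeff hX S x y else 0 := by
  have key : ∀ (a b : F) (d : S.H ⊗[k] S.H),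
      x (mul' k F (TensorProduct.map (S.act.toLinearMap.flip a) (S.act.toLinearMap.flip b) d)) =
      ∑ y, (∑ z, mul' k L (TensorProduct.map (coeff hX S x y) (coeff hX S x z) d) * z b) * y a := by
    intro a b d
    induction d with
    | zero => simp
    | add d e hd he => simp only [map_add, hd, he, add_mul, Finset.sum_add_distrib]
    | tmul h h' =>
      simp only [TensorProduct.map_tmul, mul'_apply, LinearMap.flip_apply, map_mul,
        AlgHom.toLinearMap_apply, coeff_spec hX S x h, coeff_spec hX S x h', Finset.sum_mul,
        Finset.mul_sum]
      rw [Finset.sum_comm]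
      refine Finset.sum_congr rfl fun _ _ => Finset.sum_congr rfl fun _ _ => by ring
  ext h
  have h1 : ∀ b a : F, ∑ y, (∑ z, conv (coeff hX S x y) (coeff hX S x z) h * z b) * y a =
      ∑ y, (coeff hX S x y h * y b) * y a := by
    intro b a
    have := key a b (Coalgebra.comul h)
    rw [← S.act_mul, coeff_spec hX] at this
    rw [show ∑ y, (coeff hX S x y h * y b) * y a = ∑ y, coeff hX S x y h * y (a * b) from
      Finset.sum_congr rfl fun _ _ => by rw [map_mul]; ring, this]
    rfl
  have h2 := fun b => congr_fun (eq_of_sum_mul_eq (h1 b)) y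
  have h3 : ∀ b : F, ∑ z, conv (coeff hX S x y) (coeff hX S x z) h * z b =
      ∑ z, (if y = z then coeff hX S x y h else 0) * z b := by
    intro b; rw [h2 b]; simp
  rw [congr_fun (eq_of_sum_mul_eq h3) z]
  split_ifs <;> rfl

end GreitherPareigis

/-! ### From a Hopf Galois structure to a regular permutation group normalized by Galois. -/

namespace GreitherPareigis

open LinearMap

variable {k : Type u} {F : Type v} {L : Type*} [Field k] [Field F] [Field L] [Algebra k F]
  [Algebra k L] [FiniteDimensional k F]
variable (hX : Fintype.card (F →ₐ[k] L) = Module.finrank k F) (S : HopfGaloisStructure k F)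

theorem finrank_hopf : Module.finrank k S.H = Module.finrank k F := by
  have h := (LinearEquiv.ofBijective _ S.bijective).finrank_eq
  rw [Module.finrank_tensorProduct, Module.finrank_linearMap] at h
  exact Nat.eq_of_mul_eq_mul_left Module.finrank_pos h

/-- A relation defines an `L`-linear functional on `Hom_k(F, L)` that kills every `x ∘ (s h)`.
Surjectivity of `j` makes it kill `x ∘ End_k(F)`, which spans `Hom_k(F, L)` over `L`. -/
theorem linearIndependent_coeff (x : F →ₐ[k] L) :
    LinearIndependent L (fun y => coeff hX S x y) := by
  rw [Fintype.linearIndependent_iff]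
  intro l hl
  let ψ : (F →ₗ[k] L) →ₗ[L] L := (embBasis hX).constr L l
  have hψ : ∀ f, ψ f = ∑ y, (embBasis hX).repr f y * l y := fun f => by
    simp [ψ, Module.Basis.constr_apply_fintype]
  have h1 : ∀ φ : Module.End k F, ψ (x.toLinearMap ∘ₗ φ) = 0 := by
    intro φ
    obtain ⟨d, rfl⟩ := S.bijective.2 φ
    induction d with
    | zero => simp
    | add d e hd he => rw [map_add, LinearMap.comp_add, map_add, hd, he, add_zero]
    | tmul s h =>
      have : x.toLinearMap ∘ₗ hopfGaloisMap S.act (s ⊗ₜ[k] h) =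
          x s • (x.toLinearMap ∘ₗ S.act h) := by
        ext a; simp [hopfGaloisMap_tmul]
      rw [this, map_smul, hψ]
      have h2 := congr($hl h)
      simp only [LinearMap.coe_sum, Finset.sum_apply, LinearMap.smul_apply, smul_eq_mul,
        LinearMap.zero_apply] at h2
      rw [Finset.sum_congr rfl fun y _ => mul_comm _ _]
      exact (congrArg (x s • ·) h2).trans (smul_zero _)
  have h2 : ψ = 0 := by
    let b := Module.finBasis k F
    ext f
    have : f = ∑ i, f (b i) • (x.toLinearMap ∘ₗ ((b.coord i).smulRight (1 : F))) := by
      refine b.ext fun j => ?_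
      simp [Finsupp.single_apply,]
    rw [this, map_sum]
    simp [h1]
  intro y
  have h3 := congr($h2 (embBasis hX y))
  rwa [Module.Basis.constr_basis] at h3

/-- The coefficient functions attached to `x` form an `L`-basis of `Hom_k(H, L)`. -/
noncomputable def coeffBasis (x : F →ₐ[k] L) : Module.Basis (F →ₐ[k] L) L (S.H →ₗ[k] L) :=
  haveI : Nonempty (F →ₐ[k] L) := ⟨x⟩
  basisOfLinearIndependentOfCardEqFinrank (linearIndependent_coeff hX S x)
    (by rw [hX, Module.finrank_linearMap_self, finrank_hopf])

theorem coeffBasis_apply (x y : F →ₐ[k] L) : coeffBasis hX S x y = coeff hX S x y := by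
  simp [coeffBasis]

theorem sum_coeff_eq_counit (x : F →ₐ[k] L) :
    ∑ y, coeff hX S x y = Algebra.linearMap k L ∘ₗ Coalgebra.counit := by
  ext h; simpa using sum_coeff hX S x h

theorem coeff_injective (x : F →ₐ[k] L) {y z : F →ₐ[k] L}
    (h : coeff hX S x y = coeff hX S x z) : y = z :=
  (linearIndependent_coeff hX S x).injective h

/-- For every `x` the coefficient functions form a basis of orthogonal idempotents of the same
convolution algebra, with sum the unit. Such a basis is unique: a nonzero product of a member of one
with a member of the other is a multiple of both, and proportional nonzero idempotents are equal. -/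
theorem exists_coeff_eq (x y x' : F →ₐ[k] L) : ∃ y', coeff hX S x' y' = coeff hX S x y := by
  classical
  have hne : coeff hX S x y ≠ 0 := (linearIndependent_coeff hX S x).ne_zero y
  have h1 : ∑ y', conv (coeff hX S x' y') (coeff hX S x y) = coeff hX S x y := by
    rw [← conv_sum_left, sum_coeff_eq_counit, conv_counit_left]
  obtain ⟨y', -, hy'⟩ := Finset.exists_ne_zero_of_sum_ne_zero (h1 ▸ hne)
  refine ⟨y', ?_⟩
  have e1 : ∃ a : L, conv (coeff hX S x' y') (coeff hX S x y) = a • coeff hX S x y := by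
    refine ⟨(coeffBasis hX S x).repr (coeff hX S x' y') y, ?_⟩
    conv_lhs => rw [← (coeffBasis hX S x).sum_repr (coeff hX S x' y')]
    simp [conv_sum_left, conv_smul_left, coeffBasis_apply, conv_coeff]
  have e2 : ∃ b : L, conv (coeff hX S x' y') (coeff hX S x y) = b • coeff hX S x' y' := by
    refine ⟨(coeffBasis hX S x').repr (coeff hX S x y) y', ?_⟩
    conv_lhs => rw [← (coeffBasis hX S x').sum_repr (coeff hX S x y)]
    simp [conv_sum_right, conv_smul_right, coeffBasis_apply, conv_coeff]
  obtain ⟨a, ha⟩ := e1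
  obtain ⟨b, hb⟩ := e2
  have ha0 : a ≠ 0 := by rintro rfl; simp [ha] at hy'
  have hb0 : b ≠ 0 := by rintro rfl; simp [hb] at hy'
  -- both sides are idempotent multiples of the product
  have hid : ∀ (u v : F →ₐ[k] L), conv (coeff hX S u v) (coeff hX S u v) = coeff hX S u v :=
    fun u v => by rw [conv_coeff, if_pos rfl]
  have hab : coeff hX S x' y' = (b⁻¹ * a) • coeff hX S x y := by
    rw [mul_smul, ← ha, hb, smul_smul, inv_mul_cancel₀ hb0, one_smul]
  set c := b⁻¹ * a with hc
  have hc0 : c ≠ 0 := mul_ne_zero (inv_ne_zero hb0) ha0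
  have h3 := hid x' y'
  rw [hab, conv_smul_left, conv_smul_right, hid, smul_smul] at h3
  have h4 : c * c = c := smul_left_injective L hne h3
  have h5 : c = 1 := by simpa [hc0] using h4
  rw [hab, h5, one_smul]

/-- The permutation-to-be of the embeddings attached to a coefficient function at `x₀`. -/
noncomputable def move (x₀ y₀ x : F →ₐ[k] L) : F →ₐ[k] L :=
  (exists_coeff_eq hX S x₀ y₀ x).choose

theorem coeff_move (x₀ y₀ x : F →ₐ[k] L) :
    coeff hX S x (move hX S x₀ y₀ x) = coeff hX S x₀ y₀ :=
  (exists_coeff_eq hX S x₀ y₀ x).choose_spec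

theorem move_eq_iff {x₀ y₀ x y : F →ₐ[k] L} :
    move hX S x₀ y₀ x = y ↔ coeff hX S x y = coeff hX S x₀ y₀ :=
  ⟨fun h => h ▸ coeff_move hX S x₀ y₀ x,
    fun h => coeff_injective hX S x ((coeff_move hX S x₀ y₀ x).trans h.symm)⟩

theorem move_self (x₀ y₀ : F →ₐ[k] L) : move hX S x₀ y₀ x₀ = y₀ := (move_eq_iff hX S).2 rfl

theorem move_refl (x₀ x : F →ₐ[k] L) : move hX S x₀ x₀ x = x := by
  classical
  by_contra hne
  have h := congr($(coeff_move hX S x₀ x₀ x) 1)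
  rw [coeff_one, coeff_one, if_pos rfl, if_neg (Ne.symm hne)] at h
  exact zero_ne_one h

theorem move_congr {x₀ y₀ x₁ y₁ : F →ₐ[k] L} (h : coeff hX S x₀ y₀ = coeff hX S x₁ y₁) :
    move hX S x₀ y₀ = move hX S x₁ y₁ := by
  funext x
  rw [move_eq_iff, coeff_move, h]

/-- Compatibility with the multiplication of `H` gives the group law: after reindexing, the two
expansions have the same first factors, and independence of these identifies the second factors. -/
theorem move_move (x₀ y₀ z₀ x : F →ₐ[k] L) :
    move hX S y₀ z₀ (move hX S x₀ y₀ x) = move hX S x₀ z₀ x := by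
  classical
  -- `coeff (h h')` expanded at `x₀` and at `x`
  set z := move hX S x₀ z₀ x with hz
  have hcz : coeff hX S x z = coeff hX S x₀ z₀ := coeff_move hX S x₀ z₀ x
  have key : ∀ h h' : S.H, ∑ y, coeff hX S x₀ y h * coeff hX S y z₀ h' =
      ∑ y, coeff hX S x₀ y h * coeff hX S (move hX S x₀ y x) z h' := by
    intro h h'
    rw [← coeff_mul, ← hcz, coeff_mul]
    symm
    refine Fintype.sum_bijective (fun y => move hX S x₀ y x) ?_ _ _ fun y => ?_
    · refine Finite.injective_iff_bijective.1 fun y y' hyy => ?_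
      have : coeff hX S x₀ y = coeff hX S x₀ y' := by
        rw [← coeff_move hX S x₀ y x, ← coeff_move hX S x₀ y' x]; exact congrArg (coeff hX S x) hyy
      exact coeff_injective hX S x₀ this
    · simp only [coeff_move]
  have h2 : coeff hX S y₀ z₀ = coeff hX S (move hX S x₀ y₀ x) z := by
    ext h'
    have hli := linearIndependent_coeff hX S x₀
    rw [Fintype.linearIndependent_iff] at hli
    refine sub_eq_zero.1 (hli (fun y => coeff hX S y z₀ h' - coeff hX S (move hX S x₀ y x) z h') ?_ y₀)
    ext h
    have := key h h'
    rw [← sub_eq_zero, ← Finset.sum_sub_distrib] at this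
    simpa [mul_sub, mul_comm, Finset.sum_sub_distrib] using this
  exact (move_eq_iff hX S).2 h2.symm

/-- The permutation of the embeddings `F → L` that shares the coefficient of `(x₀, y₀)`. -/
noncomputable def movePerm (x₀ y₀ : F →ₐ[k] L) : Equiv.Perm (F →ₐ[k] L) where
  toFun := move hX S x₀ y₀
  invFun := move hX S y₀ x₀
  left_inv x := by rw [move_move, move_refl]
  right_inv x := by rw [move_move, move_refl]

theorem movePerm_apply (x₀ y₀ x : F →ₐ[k] L) : movePerm hX S x₀ y₀ x = move hX S x₀ y₀ x := rfl

theorem movePerm_eq (x₀ y₀ x : F →ₐ[k] L) :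
    movePerm hX S x (move hX S x₀ y₀ x) = movePerm hX S x₀ y₀ := by
  ext1 z
  exact congr_fun (move_congr hX S (coeff_move hX S x₀ y₀ x)) z

/-- The regular group of permutations attached to a Hopf Galois structure. -/
noncomputable def permGroup : Subgroup (Equiv.Perm (F →ₐ[k] L)) where
  -- A condition free of base points: all pairs `(x, n x)` share one coefficient function.
  carrier := {n | ∀ x, n = movePerm hX S x (n x)}
  one_mem' x := by ext1 z; simp [movePerm_apply, move_refl]
  mul_mem' {m n} hm hn x := by
    ext1 z
    rw [movePerm_apply, Equiv.Perm.mul_apply, Equiv.Perm.mul_apply,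
      ← move_move hX S x (n x) _ z, ← movePerm_apply, ← movePerm_apply, ← hn x, ← hm (n x)]
  inv_mem' {n} hn x := by
    have h := hn (n⁻¹ x)
    rw [show n (n⁻¹ x) = x from n.apply_symm_apply x] at h
    rw [inv_eq_iff_mul_eq_one]
    nth_rw 1 [h]
    ext1 z
    rw [Equiv.Perm.mul_apply, movePerm_apply, movePerm_apply, move_move, move_refl,
      Equiv.Perm.one_apply]

theorem isRegular_permGroup : IsRegularPermSubgroup (permGroup hX S) := by
  intro x y
  refine ⟨movePerm hX S x y, ⟨fun z => (movePerm_eq hX S x y z).symm, move_self hX S x y⟩, ?_⟩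
  rintro n ⟨hn, rfl⟩
  exact hn x

/-- Composition with the automorphisms of `L` permutes the embeddings `F → L`. -/
def embAction (k F L : Type*) [Field k] [Field F] [Field L] [Algebra k F]
    [Algebra k L] : Gal(L/k) →* Equiv.Perm (F →ₐ[k] L) where
  toFun g :=
    { toFun := fun x => (g : L →ₐ[k] L).comp x
      invFun := fun x => ((g⁻¹ : Gal(L/k)) : L →ₐ[k] L).comp x
      left_inv := fun x => by ext a; exact g.symm_apply_apply _
      right_inv := fun x => by ext a; exact g.apply_symm_apply _ }
  map_one' := by ext; rfl
  map_mul' g h := by ext; rfl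

theorem embAction_apply (g : Gal(L/k)) (x : F →ₐ[k] L) (a : F) :
    embAction k F L g x a = g (x a) := rfl

theorem coeff_embAction (g : Gal(L/k)) (x y : F →ₐ[k] L) (h : S.H) :
    coeff hX S (embAction k F L g x) (embAction k F L g y) h = g (coeff hX S x y h) := by
  have := eq_coeff hX S (x := embAction k F L g x) (h := h)
    (f := fun y => g (coeff hX S x ((embAction k F L g).symm y) h)) (fun a => ?_)
      (embAction k F L g y)
  · simpa using this
  · rw [embAction_apply, coeff_spec hX, map_sum]
    conv_rhs => rw [← Equiv.sum_comp (embAction k F L g)]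
    simp [embAction_apply]

/-- By `coeff_embAction`, if `n` belongs to the coefficient function `c`, its conjugate by `g`
belongs to `g ∘ c`. -/
theorem conj_mem_permGroup (g : Gal(L/k)) {n : Equiv.Perm (F →ₐ[k] L)}
    (hn : n ∈ permGroup hX S) :
    embAction k F L g * n * (embAction k F L g)⁻¹ ∈ permGroup hX S := by
  intro x
  obtain ⟨x, rfl⟩ := (embAction k F L g).surjective x
  ext1 z
  obtain ⟨z, rfl⟩ := (embAction k F L g).surjective z
  symm
  have e : ∀ w, (embAction k F L g)⁻¹ (embAction k F L g w) = w := fun w =>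
    (embAction k F L g).symm_apply_apply w
  rw [Equiv.Perm.mul_apply, Equiv.Perm.mul_apply, Equiv.Perm.mul_apply, Equiv.Perm.mul_apply, e,
    e, movePerm_apply, move_eq_iff]
  ext h
  rw [coeff_embAction, coeff_embAction, (move_eq_iff hX S (x₀ := x) (y₀ := n x) (x := z)).1]
  rw [← movePerm_apply, ← hn x]

theorem exists_regular_normalized
    (hX : Fintype.card (F →ₐ[k] L) = Module.finrank k F) (S : HopfGaloisStructure k F) :
    ∃ N : Subgroup (Equiv.Perm (F →ₐ[k] L)), IsRegularPermSubgroup N ∧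
      ∀ g : Gal(L/k), ∀ n ∈ N, embAction k F L g * n * (embAction k F L g)⁻¹ ∈ N :=
  ⟨permGroup hX S, isRegular_permGroup hX S, fun g _ hn => conj_mem_permGroup hX S g hn⟩

end GreitherPareigis

/-! ### Finite computations in `2S₄`. -/

namespace TwoSFour

open Equiv

/-- The four-cycle `(0 1 2 3)`. -/
def rot : Perm (Fin 4) := ⟨![1, 2, 3, 0], ![3, 0, 1, 2], by decide, by decide⟩

/-- The double transposition `(0 1)(2 3)`. -/
def flip : Perm (Fin 4) := ⟨![1, 0, 3, 2], ![1, 0, 3, 2], by decide, by decide⟩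

/-- The generator of the direct factor of order two. -/
def zeta : TwoSFour := (Multiplicative.ofAdd 1, 1)

/-- The square of the four-cycle, in the direct factor `S₄`. -/
def sq : TwoSFour := (1, rot * rot)

/-- A dihedral subgroup of order eight of `2S₄` with trivial core. -/
def dihedral : Finset TwoSFour :=
  {(1, 1), (1, rot), (1, rot * rot), (1, rot * rot * rot),
   (Multiplicative.ofAdd 1, flip), (Multiplicative.ofAdd 1, rot * flip),
   (Multiplicative.ofAdd 1, rot * rot * flip), (Multiplicative.ofAdd 1, rot * rot * rot * flip)}

theorem card_dihedral : dihedral.card = 8 := by decide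

set_option maxRecDepth 10000 in
-- The elements of `dihedral` with trivial first coordinate form the cyclic group generated by
-- `rot`, which has only one involution.
theorem conj_sq_mem : ∀ c : Perm (Fin 4), (1, c⁻¹ * (rot * rot) * c) ∈ dihedral →
    (rot * rot) * c = c * (rot * rot) := by decide

set_option maxRecDepth 10000 in
-- Consequence used later: a normal subgroup of `2S₄` not contained in the factor of order two
-- contains `sq`.
theorem exists_conj_commutator : ∀ w : Perm (Fin 4), w ≠ 1 →
    ∃ a b : Perm (Fin 4), a * (w * b * w⁻¹ * b⁻¹) * a⁻¹ = rot * rot := by decide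

theorem sq_eq_commutator : sq = (1, rot) * (1, flip) * (1, rot)⁻¹ * (1, flip)⁻¹ := by decide

theorem zeta_notMem : zeta ∉ dihedral := by decide

set_option maxRecDepth 10000 in
theorem card_centralizer_sq :
    (Finset.univ.filter fun g : TwoSFour => g * sq = sq * g).card = 16 := by decide

theorem dihedral_pair : ∀ x ∈ dihedral, ∀ y ∈ dihedral, x ≠ 1 → y ≠ 1 → x ≠ y →
    x = sq ∨ y = sq ∨ x * x = sq ∨ y * y = sq ∨ x * y = sq ∨ x * y * (x * y) = sq := by decide

theorem sq_central : ∀ x ∈ dihedral, x * sq = sq * x := by decide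

theorem eq_sq_of_central : ∀ x ∈ dihedral, x ≠ 1 → (∀ y ∈ dihedral, y * x = x * y) →
    x = sq := by decide

/-- The noncentral involutions are the reflections, and these are exactly the elements outside the
cyclic part. -/
theorem dihedral_involution : ∀ x ∈ dihedral, x ≠ 1 → x * x = 1 → x ≠ sq →
    x.1 = Multiplicative.ofAdd 1 := by decide

end TwoSFour

/-! ### Sylow 3-subgroups of a group of order twelve. -/

section OrderTwelve

variable {N : Type*} [Group N]

theorem Sylow.card_three_of_card_eq_twelve (hN : Nat.card N = 12) :
    Nat.card (Sylow 3 N) = 1 ∨ Nat.card (Sylow 3 N) = 4 := by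
  have : Finite N := Nat.finite_of_card_ne_zero (by omega)
  obtain ⟨P⟩ : Nonempty (Sylow 3 N) := inferInstance
  have h1 := card_sylow_modEq_one 3 N
  have h2 : Nat.card (Sylow 3 N) ∣ 12 := by
    rw [← hN, P.card_eq_index_normalizer]; exact Subgroup.index_dvd_card _
  have h3 : Nat.card (Sylow 3 N) ≤ 12 := Nat.le_of_dvd (by norm_num) h2
  generalize Nat.card (Sylow 3 N) = m at *
  unfold Nat.ModEq at h1
  interval_cases m <;> simp_all

theorem Sylow.card_coe_three (hN : Nat.card N = 12) (P : Sylow 3 N) :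
    Nat.card (P : Subgroup N) = 3 := by
  have : Finite N := Nat.finite_of_card_ne_zero (by omega)
  rw [P.card_eq_multiplicity, hN, show (12 : ℕ) = 3 * 4 by norm_num,
    Nat.factorization_mul (by norm_num) (by norm_num)]
  simp [Nat.Prime.factorization_self Nat.prime_three,
    Nat.factorization_eq_zero_of_not_dvd (show ¬ 3 ∣ 4 by norm_num)]

theorem mem_zpowers_of_card_sylow_eq_one (hN : Nat.card N = 12)
    (h1 : Nat.card (Sylow 3 N) = 1) {p q : N} (hp : orderOf p = 3) (hq : orderOf q = 3) :
    q ∈ Subgroup.zpowers p := by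
  have : Finite N := Nat.finite_of_card_ne_zero (by omega)
  have hpg : ∀ x : N, orderOf x = 3 → IsPGroup 3 (Subgroup.zpowers x) := fun x hx =>
    IsPGroup.of_card (n := 1) (by rw [Nat.card_zpowers, hx]; rfl)
  obtain ⟨P, hP⟩ := (hpg p hp).exists_le_sylow
  obtain ⟨Q, hQ⟩ := (hpg q hq).exists_le_sylow
  have hPQ : Q = P := by
    have := (Nat.card_eq_one_iff_unique.1 h1).1
    exact Subsingleton.elim _ _
  have := Subgroup.eq_of_le_of_card_ge hP
    (by rw [Sylow.card_coe_three hN, Nat.card_zpowers, hp])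
  rw [this, ← hPQ]
  exact hQ (Subgroup.mem_zpowers q)

/-- With four Sylow 3-subgroups each is its own normalizer, so the kernel lies in all of them;
distinct groups of order three meet trivially. -/
theorem toPermHom_sylow_injective (hN : Nat.card N = 12) (h4 : Nat.card (Sylow 3 N) = 4) :
    Function.Injective (MulAction.toPermHom N (Sylow 3 N)) := by
  have : Finite N := Nat.finite_of_card_ne_zero (by omega)
  rw [injective_iff_map_eq_one]
  intro n hn
  have hmem : ∀ P : Sylow 3 N, n ∈ (P : Subgroup N) := by
    intro P
    have h1 : n ∈ Subgroup.normalizer (P : Set N) := by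
      rw [← Sylow.smul_eq_iff_mem_normalizer]
      exact congr($hn P)
    have h2 := (Subgroup.normalizer (P : Set N)).card_mul_index
    have h3 := P.card_eq_index_normalizer
    rw [h4] at h3
    rw [hN] at h2
    have h5 : (Subgroup.normalizer (P : Set N)).index = 4 := h3.symm
    rw [h5] at h2
    have h6 : (P : Subgroup N) = Subgroup.normalizer (P : Set N) :=
      Subgroup.eq_of_le_of_card_ge Subgroup.le_normalizer
        (by rw [Sylow.card_coe_three hN]; omega)
    rw [h6]; exact h1
  by_contra hne
  have hz : ∀ P : Sylow 3 N, Subgroup.zpowers n = P := by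
    intro P
    have hle : Subgroup.zpowers n ≤ P := by simpa using hmem P
    refine Subgroup.eq_of_le_of_card_ge hle ?_
    have hd := Subgroup.card_dvd_of_le hle
    rw [Sylow.card_coe_three hN] at hd ⊢
    rcases (Nat.dvd_prime Nat.prime_three).1 hd with h | h
    · rw [Nat.card_zpowers, orderOf_eq_one_iff] at h
      exact absurd h hne
    · exact h.ge
  have : Subsingleton (Sylow 3 N) := ⟨fun P Q => Sylow.ext ((hz P).symm.trans (hz Q))⟩
  have := Finite.card_le_one_iff_subsingleton.2 this
  omega

end OrderTwelve

/-! ### Regular permutation groups and their centralizers. -/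

section Regular

variable {X : Type*} {N : Subgroup (Equiv.Perm X)}

theorem IsRegularPermSubgroup.eq_of_apply_eq (hN : IsRegularPermSubgroup N)
    {m n : Equiv.Perm X} (hm : m ∈ N) (hn : n ∈ N) {x : X} (h : m x = n x) : m = n :=
  (hN x (n x)).unique ⟨hm, h⟩ ⟨hn, rfl⟩

theorem IsRegularPermSubgroup.card_eq (hN : IsRegularPermSubgroup N) (x : X) :
    Nat.card N = Nat.card X := by
  refine Nat.card_congr (Equiv.ofBijective (fun n : N => (n : Equiv.Perm X) x) ⟨?_, ?_⟩)
  · exact fun m n h => Subtype.ext (hN.eq_of_apply_eq m.2 n.2 h)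
  · intro y
    obtain ⟨n, ⟨hn, h⟩, -⟩ := hN x y
    exact ⟨⟨n, hn⟩, h⟩

/-- A permutation that commutes with a transitive group is determined by one value. -/
theorem IsRegularPermSubgroup.ext_of_commute (hN : IsRegularPermSubgroup N)
    {f g : Equiv.Perm X} (hf : ∀ n ∈ N, n * f = f * n) (hg : ∀ n ∈ N, n * g = g * n) {x : X}
    (h : f x = g x) : f = g := by
  ext1 y
  obtain ⟨n, ⟨hn, rfl⟩, -⟩ := hN x y
  have h1 := congr($(hf n hn) x)
  have h2 := congr($(hg n hn) x)
  simp only [Equiv.Perm.mul_apply] at h1 h2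
  rw [← h1, ← h2, h]

/-- Identify `X` with `N` through `n ↦ n x`. Then `N` acts by left translations, and the
permutations commuting with it are the right translations. -/
theorem IsRegularPermSubgroup.centralizer (hN : IsRegularPermSubgroup N) :
    IsRegularPermSubgroup (Subgroup.centralizer (N : Set (Equiv.Perm X))) := by
  intro x y
  choose f hf hf' using hN x
  have hfN : ∀ z, f z ∈ N := fun z => (hf z).1
  have hfx : ∀ z, f z x = z := fun z => (hf z).2
  have hfm : ∀ n ∈ N, ∀ z, f (n z) = n * f z := fun n hn z =>
    hN.eq_of_apply_eq (x := x) (hfN _) (N.mul_mem hn (hfN z)) (by simp [hfx])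
  have key : ∀ y z : X, f (f z y) = f z * f y := fun y z => hfm _ (hfN z) y
  -- `f z` is the element of `N` carrying `x` to `z`. Right translation by `f y` is inverted by
  -- right translation by `f y'`.
  obtain ⟨y', hy'⟩ : ∃ y', f y' = (f y)⁻¹ := ⟨(f y)⁻¹ x, by
    have := hfm _ (N.inv_mem (hfN y)) x
    rw [this]
    rw [show f x = 1 from hN.eq_of_apply_eq (x := x) (hfN x) N.one_mem (by simp [hfx]), mul_one]⟩
  let c : Equiv.Perm X :=
    { toFun := fun z => f z y
      invFun := fun z => f z y'
      left_inv := fun z => by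
        have h1 : f y y' = x := by rw [← hfx y', hy', ← Equiv.Perm.mul_apply]; simp
        change f (f z y) y' = z
        rw [key, Equiv.Perm.mul_apply, h1, hfx]
      right_inv := fun z => by
        have h1 : f y' y = x := by rw [hy']; nth_rw 2 [← hfx y]; simp
        change f (f z y') y = z
        rw [key, Equiv.Perm.mul_apply, h1, hfx] }
  have hc : c ∈ Subgroup.centralizer (N : Set (Equiv.Perm X)) := by
    rw [Subgroup.mem_centralizer_iff]
    intro n hn
    ext1 z
    change n (f z y) = f (n z) y
    rw [hfm n hn]; rfl
  refine ⟨c, ⟨hc, ?_⟩, ?_⟩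
  · change f x y = y
    rw [show f x = 1 from hN.eq_of_apply_eq (x := x) (hfN x) N.one_mem (by simp [hfx])]; rfl
  · rintro d ⟨hd, hdx⟩
    rw [Subgroup.mem_centralizer_iff] at hd hc
    refine hN.ext_of_commute hd hc (x := x) ?_
    rw [hdx]
    change y = f x y
    rw [show f x = 1 from hN.eq_of_apply_eq (x := x) (hfN x) N.one_mem (by simp [hfx])]; rfl

/-- Both `f` and the element of `N` agreeing with it at `x` commute with the centralizer, which is
transitive, so they coincide. -/
theorem IsRegularPermSubgroup.mem_of_mem_centralizer_centralizer (hN : IsRegularPermSubgroup N)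
    {f : Equiv.Perm X} (x : X)
    (hf : f ∈ Subgroup.centralizer
      (Subgroup.centralizer (N : Set (Equiv.Perm X)) : Set (Equiv.Perm X))) : f ∈ N := by
  obtain ⟨n, ⟨hn, h⟩, -⟩ := hN x (f x)
  have : f = n := by
    rw [Subgroup.mem_centralizer_iff] at hf
    refine hN.centralizer.ext_of_commute (x := x) hf (fun c hc => ?_) h.symm
    rw [Subgroup.mem_centralizer_iff] at hc
    exact (hc n hn).symm
  exact this ▸ hn

end Regular

/-- Conjugation by the permutations of a group that normalizes `N`, as automorphisms of `N`. -/
def conjAut {G X : Type*} [Group G] (lam : G →* Equiv.Perm X) (N : Subgroup (Equiv.Perm X))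
    (hnorm : ∀ g : G, ∀ n ∈ N, lam g * n * (lam g)⁻¹ ∈ N) : G →* MulAut N where
  toFun g :=
    { toFun := fun n => ⟨lam g * n * (lam g)⁻¹, hnorm g n n.2⟩
      invFun := fun n => ⟨(lam g)⁻¹ * n * lam g, by simpa using hnorm g⁻¹ n n.2⟩
      left_inv := fun n => Subtype.ext (by group)
      right_inv := fun n => Subtype.ext (by group)
      map_mul' := fun m n => Subtype.ext (by simp [mul_assoc]) }
  map_one' := by ext1 n; exact Subtype.ext (by simp)
  map_mul' g h := by ext1 n; exact Subtype.ext (by simp [mul_assoc])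

theorem coe_conjAut {G X : Type*} [Group G] (lam : G →* Equiv.Perm X)
    (N : Subgroup (Equiv.Perm X)) (hnorm : ∀ g : G, ∀ n ∈ N, lam g * n * (lam g)⁻¹ ∈ N) (g : G)
    (n : N) : (conjAut lam N hnorm g n : Equiv.Perm X) = lam g * n * (lam g)⁻¹ := rfl

theorem conj_mem_centralizer {G X : Type*} [Group G] (lam : G →* Equiv.Perm X)
    (N : Subgroup (Equiv.Perm X)) (hnorm : ∀ g : G, ∀ n ∈ N, lam g * n * (lam g)⁻¹ ∈ N) (g : G) :
    ∀ c ∈ Subgroup.centralizer (N : Set (Equiv.Perm X)),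
      lam g * c * (lam g)⁻¹ ∈ Subgroup.centralizer (N : Set (Equiv.Perm X)) := by
  intro c hc
  rw [Subgroup.mem_centralizer_iff] at hc ⊢
  intro n hn
  have h := hc _ (hnorm g⁻¹ n hn)
  simp only [map_inv, inv_inv] at h
  calc n * (lam g * c * (lam g)⁻¹) = lam g * ((lam g)⁻¹ * n * lam g * c) * (lam g)⁻¹ := by group
    _ = lam g * c * (lam g)⁻¹ * n := by rw [h]; group

/-! ### No regular group of degree twelve is normalized by `2S₄`. -/

namespace TwoSFour

open Equiv

section

variable {S : Subgroup TwoSFour} (hS : ∀ x ∈ S, x ∈ dihedral) (hsq : sq ∈ S)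
  {X : Type*} [Fintype X] (lam : TwoSFour →* Perm X) (x₀ : X)
  (hst : ∀ g, lam g x₀ = x₀ ↔ g ∈ S) (htr : ∀ x, ∃ g, lam g x₀ = x)
  {N : Subgroup (Perm X)} (hN : IsRegularPermSubgroup N)
  (hnorm : ∀ g, ∀ n ∈ N, lam g * n * (lam g)⁻¹ ∈ N)

include hS hst htr

/-- If `sq` fixes `g x₀`, then `g⁻¹ sq g` lies in the stabilizer `S`, and `sq` is its only conjugate
there. So the fixed points of `sq` lie in one orbit of its centralizer. -/
theorem lam_sq_apply_eq_iff (x : X) :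
    lam sq x = x → ∃ g : TwoSFour, sq * g = g * sq ∧ lam g x₀ = x := by
  intro hx
  obtain ⟨g, rfl⟩ := htr x
  refine ⟨g, ?_, rfl⟩
  have h1 : g⁻¹ * sq * g ∈ S := by
    rw [← hst, map_mul, map_mul, map_inv, Perm.mul_apply, Perm.mul_apply, hx]
    exact (lam g).symm_apply_apply _
  have h2 := hS _ h1
  obtain ⟨a, c⟩ := g
  have h3 : (a, c)⁻¹ * sq * (a, c) = (1, c⁻¹ * (rot * rot) * c) := by
    simp [sq]
  rw [h3] at h2
  have := conj_sq_mem c h2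
  simp [sq, this]

theorem lam_sq_ne_one : lam sq ≠ 1 := by
  intro h
  have h1 : ∀ c : Perm (Fin 4), (rot * rot) * c = c * (rot * rot) := fun c => by
    refine conj_sq_mem c (hS _ ?_)
    have : ((1, c⁻¹ * (rot * rot) * c) : TwoSFour) = (1, c)⁻¹ * sq * (1, c) := by simp [sq]
    rw [this, ← hst, map_mul, map_mul, h, mul_one, map_inv, inv_mul_cancel]; rfl
  exact absurd (h1 (Equiv.swap 0 1)) (by decide)

include hsq hN hnorm

/-- Automorphisms of a cyclic group commute, so on a unique Sylow 3-subgroup of `N` the commutator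
`sq` acts trivially. An element of order three would then act without fixed points on the fixed
points of `sq`, whose number is a power of two. -/
theorem card_sylow_three_ne_one (hcard : Nat.card N = 12) : Nat.card (Sylow 3 N) ≠ 1 := by
  classical
  intro h1
  have : Fact (Nat.Prime 3) := ⟨Nat.prime_three⟩
  have : Finite N := Nat.finite_of_card_ne_zero (by omega)
  obtain ⟨p, hp⟩ := exists_prime_orderOf_dvd_card' (G := N) 3 (by rw [hcard]; norm_num)
  set A := conjAut lam N hnorm with hA
  have hord : ∀ g, orderOf (A g p) = 3 := fun g => by
    rw [← hp]; exact orderOf_injective (A g).toMonoidHom (A g).injective p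
  have hcomm : ∀ a b, A (a * b) p = A (b * a) p := by
    intro a b
    obtain ⟨i, hi⟩ := mem_zpowers_of_card_sylow_eq_one hcard h1 hp (hord a)
    obtain ⟨j, hj⟩ := mem_zpowers_of_card_sylow_eq_one hcard h1 hp (hord b)
    simp only at hi hj
    rw [map_mul, map_mul, MulAut.mul_apply, MulAut.mul_apply, ← hi, ← hj, map_zpow, map_zpow,
      ← hi, ← hj, ← zpow_mul, ← zpow_mul, mul_comm]
  -- Since `sq * flip * rot = rot * flip`, this element is fixed by `sq` as soon as `A` is
  -- commutative at `p`.
  set q := A ((1, flip) * (1, rot)) p with hq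
  have hq3 : orderOf q = 3 := hord _
  have hsqq : A sq q = q := by
    rw [hq, ← MulAut.mul_apply, ← map_mul]
    conv_rhs => rw [← hcomm]
    rw [← mul_assoc, show sq * (1, flip) * (1, rot) = ((1, rot) * (1, flip) : TwoSFour) by
      rw [sq_eq_commutator]; group]
  have hsqq' : ∀ x, lam sq ((q : Perm X) x) = (q : Perm X) (lam sq x) := by
    intro x
    have := congr(($hsqq : Perm X) (lam sq x))
    rw [coe_conjAut] at this
    simpa using this
  let Y := {x : X // lam sq x = x}
  let f : Function.End Y := fun y => ⟨(q : Perm X) y, by rw [hsqq', y.2]⟩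
  have hf3 : f ^ 3 ^ 1 = 1 := by
    funext y
    refine Subtype.ext ?_
    have h3 : (q : Perm X) ^ 3 = 1 := by
      have := pow_orderOf_eq_one q
      rw [hq3] at this
      exact congrArg Subtype.val this
    have := congr($h3 (y : X))
    have h4 : (q : Perm X) ((q : Perm X) ((q : Perm X) y)) = y := by simpa [pow_succ] using this
    exact h4
  have hfix : Fintype.card (Function.fixedPoints f) = 0 := by
    rw [Fintype.card_eq_zero_iff]
    refine ⟨fun y => ?_⟩
    have h2 : (q : Perm X) (y : Y).1 = (y : Y).1 := congrArg Subtype.val y.2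
    have h3 : (q : Perm X) = 1 := hN.eq_of_apply_eq q.2 N.one_mem h2
    have h4 : q = 1 := Subtype.ext h3
    rw [h4, orderOf_one] at hq3
    omega
  have hmod := Perm.card_fixedPoints_modEq hf3
  rw [hfix] at hmod
  letI : MulAction TwoSFour X := MulAction.compHom X lam
  let C := Subgroup.centralizer ({sq} : Set TwoSFour)
  have hC : IsPGroup 2 C := by
    refine IsPGroup.of_card (n := 4) ?_
    rw [Nat.card_eq_fintype_card]
    refine Eq.trans ?_ card_centralizer_sq
    refine Fintype.card_of_subtype _ fun g => ?_
    simp only [Finset.mem_filter, Finset.mem_univ, true_and, C]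
    rw [Subgroup.mem_centralizer_singleton_iff]
  obtain ⟨n, hn⟩ := hC.card_orbit x₀
  have horb : MulAction.orbit C x₀ = {x | lam sq x = x} := by
    ext x
    constructor
    · rintro ⟨⟨g, hg⟩, rfl⟩
      rw [Subgroup.mem_centralizer_singleton_iff] at hg
      change lam sq (lam g x₀) = lam g x₀
      rw [← Perm.mul_apply, ← map_mul]
      rw [← hg, map_mul, Perm.mul_apply, (hst sq).2 hsq]
    · intro hx
      obtain ⟨g, hg, rfl⟩ := lam_sq_apply_eq_iff hS lam x₀ hst htr x hx
      refine ⟨⟨g, ?_⟩, rfl⟩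
      rw [Subgroup.mem_centralizer_singleton_iff]
      exact hg.symm
  rw [horb] at hn
  have hY : Fintype.card Y = 2 ^ n := by
    rw [← hn, Nat.card_eq_fintype_card]; rfl
  rw [hY] at hmod
  have : 3 ∣ 2 ^ n := (Nat.modEq_zero_iff_dvd).1 hmod
  have := (Nat.prime_three).dvd_of_dvd_pow this
  omega

/-- `N` acts faithfully on its four Sylow 3-subgroups, on which `2S₄` acts too through automorphisms
of `N`. This gives the trivial centre, and the kernel of the second action is what centralizes `N`.
-/
theorem zeta_centralizes (hcard : Nat.card N = 12) :
    (∀ n ∈ N, n * lam zeta = lam zeta * n) ∧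
      (∀ m ∈ N, (∀ n ∈ N, n * m = m * n) → m = 1) := by
  classical
  have h4 : Nat.card (Sylow 3 N) = 4 :=
    (Sylow.card_three_of_card_eq_twelve hcard).resolve_left
      (card_sylow_three_ne_one hS hsq lam x₀ hst htr hN hnorm hcard)
  have hinj := toPermHom_sylow_injective hcard h4
  have : Finite N := Nat.finite_of_card_ne_zero (by omega)
  have : Fintype (Sylow 3 N) := Fintype.ofFinite _
  set A := conjAut lam N hnorm with hA
  let φ : TwoSFour →* Perm (Sylow 3 N) := (MulAction.toPermHom (MulAut N) (Sylow 3 N)).comp A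
  have hconj : ∀ (α : MulAut N) (n : N), MulAut.conj (α n) = α * MulAut.conj n * α⁻¹ := by
    intro α n
    ext1 m
    simp [MulAut.conj_apply]
  have hκ : ∀ n : N, MulAction.toPermHom N (Sylow 3 N) n =
      MulAction.toPermHom (MulAut N) (Sylow 3 N) (MulAut.conj n) := fun n => rfl
  -- If `w` fixes all four Sylow subgroups, `n` and its conjugate by `w` permute them in the same
  -- way, hence are equal.
  have hW : ∀ w, φ w = 1 → ∀ n ∈ N, n * lam w = lam w * n := by
    intro w hw n hn
    have h1 : A w ⟨n, hn⟩ = ⟨n, hn⟩ := by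
      apply hinj
      have hw' : MulAction.toPermHom (MulAut N) (Sylow 3 N) (A w) = 1 := hw
      rw [hκ, hκ, hconj, map_mul, map_mul, map_inv, hw', one_mul, inv_one, mul_one]
    have h2 := congrArg Subtype.val h1
    rw [coe_conjAut] at h2
    exact (mul_inv_eq_iff_eq_mul.1 h2).symm
  constructor
  · refine hW zeta ?_
    have hker : ¬ Function.Injective φ := by
      intro hφ
      have h := Fintype.card_le_of_injective φ hφ
      rw [Fintype.card_perm, ← Nat.card_eq_fintype_card (α := Sylow 3 N), h4, Fintype.card_prod,
        Fintype.card_perm] at h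
      simp [Nat.factorial] at h
    rw [injective_iff_map_eq_one] at hker
    push Not at hker
    obtain ⟨w, hw, hw1⟩ := hker
    by_cases hw2 : w.2 = 1
    · have : w = zeta := by
        obtain ⟨a, b⟩ := w
        simp only at hw2
        subst hw2
        have : ∀ a : Multiplicative (ZMod 2), (a, (1 : Perm (Fin 4))) ≠ 1 →
          (a, (1 : Perm (Fin 4))) = zeta := by decide
        exact this a hw1
      exact this ▸ hw
    · exfalso
      -- A kernel element with nontrivial part in `S₄` would put `sq` in the kernel. But `sq` fixes
      -- `x₀`, so commuting with the transitive group `N` it would be the identity permutation.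
      obtain ⟨a, b, hab⟩ := exists_conj_commutator w.2 hw2
      have h1 : φ sq = 1 := by
        have : sq = (1, a) * (w * (1, b) * w⁻¹ * (1, b)⁻¹) * (1, a)⁻¹ := by
          refine Prod.ext ?_ ?_
          · simp [sq]
          · simpa [sq] using hab.symm
        rw [this]
        simp only [map_mul, map_inv, hw]
        group
      have h2 := hN.ext_of_commute (f := lam sq) (g := 1) (hW sq h1) (by simp) (x := x₀)
        ((hst sq).2 hsq)
      exact lam_sq_ne_one hS lam x₀ hst htr h2
  · intro m hm hcm
    have : (⟨m, hm⟩ : N) = 1 := by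
      apply hinj
      rw [hκ, show MulAut.conj (⟨m, hm⟩ : N) = 1 from ?_, map_one, map_one]
      ext1 n
      have := hcm n n.2
      exact Subtype.ext (by simp [MulAut.conj_apply, ← this])
    exact congrArg Subtype.val this

/-- No regular group of permutations of `G/S` is normalized by `G = 2S₄` if `S` is a subgroup of
index `12` of the dihedral subgroup. -/
theorem not_normalized_regular (hcard : Fintype.card X = 12) : False := by
  have hN12 : Nat.card N = 12 := by rw [hN.card_eq x₀, Nat.card_eq_fintype_card, hcard]
  have hC := hN.centralizer
  have hCnorm := conj_mem_centralizer lam N hnorm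
  have hC12 : Nat.card (Subgroup.centralizer (N : Set (Perm X))) = 12 := by
    rw [hC.card_eq x₀, Nat.card_eq_fintype_card, hcard]
  obtain ⟨h1, h2⟩ := zeta_centralizes hS hsq lam x₀ hst htr hN hnorm hN12
  obtain ⟨h3, -⟩ := zeta_centralizes hS hsq lam x₀ hst htr hC hCnorm hC12
  -- `zeta` also centralizes the centralizer of `N`, so it lies in the double centralizer.
  have h4 : lam zeta ∈ N := by
    refine hN.mem_of_mem_centralizer_centralizer x₀ ?_
    rw [Subgroup.mem_centralizer_iff]
    exact h3
  have h5 := h2 _ h4 h1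
  have h6 : zeta ∈ S := by rw [← hst, h5]; rfl
  exact zeta_notMem (hS _ h6)

end

end TwoSFour

/-- A subgroup with trivial core has no element all of whose conjugates it contains. -/
theorem Subgroup.eq_one_of_forall_conj_mem {G : Type*} [Group G] {H : Subgroup G}
    (hcore : ∀ W : Subgroup G, W.Normal → W ≤ H → W = ⊥) {x : G}
    (hx : ∀ g, g * x * g⁻¹ ∈ H) : x = 1 := by
  have h1 : Subgroup.normalClosure {x} ≤ H := by
    rw [Subgroup.normalClosure, Subgroup.closure_le]
    intro y hy
    rw [Group.mem_conjugatesOfSet_iff] at hy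
    obtain ⟨z, rfl, hz⟩ := hy
    obtain ⟨g, rfl⟩ := isConj_iff.1 hz
    exact hx g
  have h2 := hcore _ Subgroup.normalClosure_normal h1
  have h3 : x ∈ Subgroup.normalClosure {x} := Subgroup.subset_normalClosure rfl
  rwa [h2, Subgroup.mem_bot] at h3

/-! ### Subgroups of order eight of `2S₄` with trivial core. -/

namespace TwoSFour

open Equiv

/-- The sign of a permutation, in the multiplicative group `ZMod 2`. -/
def signHom : Perm (Fin 4) →* Multiplicative (ZMod 2) :=
  MonoidHom.comp
    { toFun := fun u : ℤˣ => if u = 1 then 1 else Multiplicative.ofAdd 1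
      map_one' := by decide
      map_mul' := by decide } Perm.sign

theorem signHom_rot : signHom rot = Multiplicative.ofAdd 1 := by decide

theorem signHom_flip : signHom flip = 1 := by decide

theorem multiplicative_zmod_two_mul_self (c : Multiplicative (ZMod 2)) : c * c = 1 := by
  revert c; decide

/-- The automorphism `(c, σ) ↦ (c + sgn σ, σ)` of `2S₄`. -/
def signTwist : TwoSFour ≃* TwoSFour where
  toFun x := (x.1 * signHom x.2, x.2)
  invFun x := (x.1 * signHom x.2, x.2)
  left_inv x := by simp [mul_assoc, multiplicative_zmod_two_mul_self]
  right_inv x := by simp [mul_assoc, multiplicative_zmod_two_mul_self]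
  map_mul' x y := by
    refine Prod.ext ?_ rfl
    simp [mul_mul_mul_comm]

set_option maxRecDepth 10000 in
theorem conj_flip : ∀ c : Perm (Fin 4), c * flip * c⁻¹ = flip ∨ c * flip * c⁻¹ = rot * rot ∨
    c * flip * c⁻¹ = rot * rot * flip := by decide

theorem zeta_central (g : TwoSFour) : g * zeta * g⁻¹ = zeta := by
  refine Prod.ext ?_ ?_
  · simp [zeta, mul_comm]
  · simp [zeta]

theorem fst_eq_one_or (c : Multiplicative (ZMod 2)) : c = 1 ∨ c = Multiplicative.ofAdd 1 := by
  revert c; decide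

set_option maxRecDepth 10000 in
theorem card_centralizer_rot_sq :
    (Finset.univ.filter fun g : Perm (Fin 4) => g * (rot * rot) = rot * rot * g).card = 8 := by
  decide

variable {H : Subgroup TwoSFour}

/-- Without `zeta`, `H` projects injectively to `S₄`. Its image is a Sylow 2-subgroup, hence
conjugate to the centralizer of `rot * rot`, which also has order eight. -/
theorem exists_conj_map_snd (hcard : Nat.card H = 8) (hζ : zeta ∉ H) :
    ∃ g : Perm (Fin 4), ∀ y : Perm (Fin 4), y * (rot * rot) = rot * rot * y →
      ∃ c, (c, g⁻¹ * y * g) ∈ H := by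
  classical
  have : Fact (Nat.Prime 2) := ⟨Nat.prime_two⟩
  have hinj : Function.Injective ((MonoidHom.snd (Multiplicative (ZMod 2)) (Perm (Fin 4))).comp
      H.subtype) := by
    rw [injective_iff_map_eq_one]
    rintro ⟨⟨c, σ⟩, hx⟩ h
    have h' : σ = 1 := h
    subst h'
    rcases fst_eq_one_or c with rfl | rfl
    · rfl
    · exact absurd hx hζ
  set D := ((MonoidHom.snd (Multiplicative (ZMod 2)) (Perm (Fin 4))).comp H.subtype).range with hD
  have hDc : Nat.card D = 8 := by
    rw [← hcard]; exact (Nat.card_congr (MonoidHom.ofInjective hinj).toEquiv).symm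
  let E := Subgroup.centralizer ({rot * rot} : Set (Perm (Fin 4)))
  have hEc : Nat.card E = 8 := by
    rw [Nat.card_eq_fintype_card]
    refine Eq.trans ?_ card_centralizer_rot_sq
    refine Fintype.card_of_subtype _ fun g => ?_
    simp only [Finset.mem_filter, Finset.mem_univ, true_and, E]
    rw [Subgroup.mem_centralizer_singleton_iff]
  have hfac : 2 ^ (Nat.card (Perm (Fin 4))).factorization 2 = 8 := by
    have : Nat.card (Perm (Fin 4)) = 2 ^ 3 * 3 := by
      rw [Nat.card_eq_fintype_card, Fintype.card_perm]; rfl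
    rw [this, Nat.factorization_mul (by norm_num) (by norm_num), Finsupp.add_apply,
      Nat.prime_two.factorization_pow, Nat.factorization_eq_zero_of_not_dvd (show ¬ 2 ∣ 3 by norm_num)]
    simp
  obtain ⟨g, hg⟩ := MulAction.exists_smul_eq (Perm (Fin 4))
    (Sylow.ofCard D (hDc.trans hfac.symm)) (Sylow.ofCard E (hEc.trans hfac.symm))
  refine ⟨g, fun y hy => ?_⟩
  have hyE : y ∈ (Sylow.ofCard E (hEc.trans hfac.symm) : Subgroup (Perm (Fin 4))) := by
    change y ∈ E
    rw [Subgroup.mem_centralizer_singleton_iff]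
    exact hy
  rw [← hg, Sylow.coe_subgroup_smul] at hyE
  obtain ⟨z, hz, rfl⟩ := hyE
  obtain ⟨⟨⟨c, σ⟩, hx⟩, rfl⟩ := (hz : z ∈ D)
  refine ⟨c, ?_⟩
  simpa [mul_assoc] using hx

/-- Up to automorphisms, `2S₄` has one subgroup of order eight with trivial core. -/
theorem exists_equiv_dihedral (hcard : Nat.card H = 8)
    (hcore : ∀ W : Subgroup TwoSFour, W.Normal → W ≤ H → W = ⊥) :
    ∃ e : TwoSFour ≃* TwoSFour, ∀ x, x ∈ H ↔ e x ∈ dihedral := by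
  classical
  have hζ : zeta ∉ H := fun h => by
    have := Subgroup.eq_one_of_forall_conj_mem hcore (x := zeta) fun g => by
      rw [zeta_central]; exact h
    exact absurd this (by decide)
  obtain ⟨g, hg⟩ := exists_conj_map_snd hcard hζ
  obtain ⟨a, ha⟩ := hg rot (mul_assoc _ _ _).symm
  obtain ⟨b, hb⟩ := hg flip (by decide)
  let e₁ : TwoSFour ≃* TwoSFour := MulAut.conj (1, g)
  -- `rot` is odd and `flip` is even, so the sign twist corrects the first coordinate over `rot`
  -- without changing the one over `flip`.
  have h1 : ∃ e : TwoSFour ≃* TwoSFour, e (a, g⁻¹ * rot * g) = (1, rot) ∧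
      e (b, g⁻¹ * flip * g) = (b, flip) := by
    have q1 : e₁ (a, g⁻¹ * rot * g) = (a, rot) := by simp [e₁, MulAut.conj_apply, mul_assoc]
    have q2 : e₁ (b, g⁻¹ * flip * g) = (b, flip) := by simp [e₁, MulAut.conj_apply, mul_assoc]
    rcases fst_eq_one_or a with rfl | rfl
    · exact ⟨e₁, q1, q2⟩
    · refine ⟨e₁.trans signTwist, ?_, ?_⟩
      · rw [MulEquiv.trans_apply, q1]
        simp only [signTwist, MulEquiv.coe_mk, Equiv.coe_fn_mk, signHom_rot]
        rw [multiplicative_zmod_two_mul_self]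
      · rw [MulEquiv.trans_apply, q2]
        simp [signTwist, signHom_flip]
  obtain ⟨e, he1, he2⟩ := h1
  have hr : e.symm (1, rot) ∈ H := by rw [← he1, e.symm_apply_apply]; exact ha
  have hf : e.symm (b, flip) ∈ H := by rw [← he2, e.symm_apply_apply]; exact hb
  -- Otherwise `H` contains, up to the automorphism `e`, the Klein four-group of `S₄`, which is
  -- normal.
  have hb1 : b = Multiplicative.ofAdd 1 := by
    refine (fst_eq_one_or b).resolve_left ?_
    rintro rfl
    have : e.symm (1, flip) = 1 := by
      refine Subgroup.eq_one_of_forall_conj_mem hcore fun x => ?_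
      obtain ⟨⟨c, σ⟩, rfl⟩ := e.symm.surjective x
      rw [← map_inv, ← map_mul, ← map_mul]
      have h2 : ((c, σ) * (1, flip) * (c, σ)⁻¹ : TwoSFour) = (1, σ * flip * σ⁻¹) := by simp
      rw [h2]
      rcases conj_flip σ with h | h | h <;> rw [h]
      · exact hf
      · simpa [← map_mul] using H.mul_mem hr hr
      · simpa [← map_mul] using H.mul_mem (H.mul_mem hr hr) hf
    rw [EmbeddingLike.map_eq_one_iff] at this
    exact absurd this (by decide)
  subst hb1
  have hsub : ∀ x ∈ dihedral, e.symm x ∈ H := by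
    have hm : ∀ x y, e.symm x ∈ H → e.symm y ∈ H → e.symm (x * y) ∈ H := fun x y hx hy => by
      rw [map_mul]; exact H.mul_mem hx hy
    have hr2 := hm _ _ hr hr
    have hr3 := hm _ _ hr2 hr
    intro x hx
    simp only [dihedral, Finset.mem_insert, Finset.mem_singleton] at hx
    rcases hx with rfl | rfl | rfl | rfl | rfl | rfl | rfl | rfl
    · rw [show ((1, 1) : TwoSFour) = 1 from rfl, map_one]; exact H.one_mem
    · exact hr
    · exact hr2
    · exact hr3
    · exact hf
    · exact hm _ _ hr hf
    · exact hm _ _ hr2 hf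
    · exact hm _ _ hr3 hf
  refine ⟨e, fun x => ⟨fun hx => ?_, fun hx => by simpa using hsub _ hx⟩⟩
  let T : Finset TwoSFour := Finset.univ.filter fun y => e.symm y ∈ H
  have hT : T.card = 8 := by
    rw [← hcard, Nat.card_eq_fintype_card]
    symm
    refine Fintype.card_of_bijective (f := fun x : H => (⟨e x, by simp [T]⟩ : T)) ⟨?_, ?_⟩ |>.trans
      (Fintype.card_coe _)
    · intro x y hxy
      exact Subtype.ext (e.injective (congrArg Subtype.val hxy))
    · rintro ⟨y, hy⟩
      exact ⟨⟨e.symm y, by simpa [T] using hy⟩, Subtype.ext (e.apply_symm_apply y)⟩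
  have hdT : dihedral = T := by
    refine Finset.eq_of_subset_of_card_le (fun y hy => ?_) (by rw [hT, card_dihedral])
    simp [T, hsub y hy]
  rw [hdT]
  simp [T, hx]

end TwoSFour

/-! ### Descent of Hopf algebras along a field extension. -/

section TensorDescent

variable {k M : Type*} [Field k] [Field M] [Algebra k M]
  {V V' W W' : Type*} [AddCommGroup V] [Module k V] [AddCommGroup V'] [Module k V']
  [AddCommGroup W] [Module k W] [Module M W] [IsScalarTower k M W]
  [AddCommGroup W'] [Module k W'] [Module M W'] [IsScalarTower k M W']

/-- The tensor product of two `k`-linear maps into `M`-modules, with values in the tensor product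
over `M`. -/
noncomputable def tensorMapOver (M : Type*) [Field M] [Algebra k M] [Module M W]
    [IsScalarTower k M W] [Module M W'] [IsScalarTower k M W'] (f : V →ₗ[k] W) (g : V' →ₗ[k] W') :
    V ⊗[k] V' →ₗ[k] W ⊗[M] W' :=
  TensorProduct.lift (LinearMap.mk₂ k (fun x y => f x ⊗ₜ[M] g y)
    (fun x x' y => by simp [TensorProduct.add_tmul])
    (fun c x y => by simp [TensorProduct.smul_tmul'])
    (fun x y y' => by simp [TensorProduct.tmul_add])
    (fun c x y => by simp))

@[simp]
theorem tensorMapOver_tmul (f : V →ₗ[k] W) (g : V' →ₗ[k] W') (x : V) (y : V') :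
    tensorMapOver M f g (x ⊗ₜ y) = f x ⊗ₜ[M] g y := by
  rw [tensorMapOver, TensorProduct.lift.tmul]; rfl

theorem linearIndependent_restrict (M : Type*) [Field M] [Algebra k M] [Module M W]
    [IsScalarTower k M W] {ι : Type*} {w : ι → W} (hw : LinearIndependent M w) :
    LinearIndependent k w :=
  hw.restrict_scalars (by
    intro a a' h
    simpa [Algebra.smul_def] using h)

theorem injective_of_basis_linearIndependent {ι : Type*} (v : Module.Basis ι k V)
    {f : V →ₗ[k] W} (hf : LinearIndependent M (fun i => f (v i))) : Function.Injective f :=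
  LinearMap.injective_of_linearIndependent v.span_eq (linearIndependent_restrict M hf)

theorem tensorMapOver_basis {ι κ : Type*} (v : Module.Basis ι k V) (v' : Module.Basis κ k V')
    {f : V →ₗ[k] W} {g : V' →ₗ[k] W'} (hf : LinearIndependent M (fun i => f (v i)))
    (hg : LinearIndependent M (fun i => g (v' i))) :
    LinearIndependent M (fun i => tensorMapOver M f g (v.tensorProduct v' i)) := by
  simpa [Module.Basis.tensorProduct_apply'] using hf.tmul_of_isDomain hg

end TensorDescent

/-- A `k`-form of an `M`-Hopf algebra `B`, for a field extension `M/k`: a `k`-subalgebra of `B`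
with a `k`-basis that is linearly independent over `M`, compatible with the Hopf algebra
operations. -/
structure HopfForm (k M B : Type*) [Field k] [Field M] [Algebra k M] [Ring B] [HopfAlgebra M B]
    [Algebra k B] [IsScalarTower k M B] where
  H : Subalgebra k B
  ι : Type*
  basis : Module.Basis ι k H
  indep : LinearIndependent M (fun i => (basis i : B))
  exists_comul (h : H) : ∃ d : H ⊗[k] H,
    tensorMapOver M H.val.toLinearMap H.val.toLinearMap d = Coalgebra.comul (R := M) (h : B)
  exists_counit (h : H) : ∃ c : k, algebraMap k M c = Coalgebra.counit (R := M) (h : B)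
  antipode_mem (h : H) : HopfAlgebra.antipode M (h : B) ∈ H

namespace HopfForm

variable {k M B : Type*} [Field k] [Field M] [Algebra k M] [Ring B] [HopfAlgebra M B]
    [Algebra k B] [IsScalarTower k M B] (D : HopfForm k M B)

/-- The inclusion of a form, as a linear map. -/
noncomputable abbrev incl : D.H →ₗ[k] B := D.H.val.toLinearMap

/-- The inclusion of the tensor square of a form. -/
noncomputable abbrev incl₂ : D.H ⊗[k] D.H →ₗ[k] B ⊗[M] B := tensorMapOver M D.incl D.incl

/-- The inclusion of the tensor cube of a form. -/
noncomputable abbrev incl₃ : D.H ⊗[k] (D.H ⊗[k] D.H) →ₗ[k] B ⊗[M] (B ⊗[M] B) :=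
  tensorMapOver M D.incl D.incl₂

/-- Injectivity on tensor powers serves twice: it makes the comultiplication of the form well
defined and linear, and it reduces its axioms to those of `B`. -/
theorem incl₂_injective : Function.Injective D.incl₂ :=
  injective_of_basis_linearIndependent (M := M) _
    (tensorMapOver_basis D.basis D.basis D.indep D.indep)

theorem incl₃_injective : Function.Injective D.incl₃ :=
  injective_of_basis_linearIndependent (M := M) _
    (tensorMapOver_basis D.basis _ D.indep (tensorMapOver_basis D.basis D.basis D.indep D.indep))

/-- The comultiplication of a form. -/
noncomputable def comul : D.H →ₗ[k] D.H ⊗[k] D.H where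
  toFun h := (D.exists_comul h).choose
  map_add' x y := D.incl₂_injective (by
    rw [map_add, (D.exists_comul _).choose_spec, (D.exists_comul _).choose_spec,
      (D.exists_comul _).choose_spec, Subalgebra.coe_add, map_add])
  map_smul' c x := D.incl₂_injective (by
    rw [map_smul, (D.exists_comul _).choose_spec, (D.exists_comul _).choose_spec,
      Subalgebra.coe_smul, RingHom.id_apply, ← algebraMap_smul M c (x : B), map_smul,
      algebraMap_smul])

theorem incl₂_comul (h : D.H) : D.incl₂ (D.comul h) = Coalgebra.comul (R := M) (h : B) :=
  (D.exists_comul h).choose_spec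

/-- The counit of a form. -/
noncomputable def counit : D.H →ₗ[k] k where
  toFun h := (D.exists_counit h).choose
  map_add' x y := (algebraMap k M).injective (by
    rw [map_add, (D.exists_counit _).choose_spec, (D.exists_counit _).choose_spec,
      (D.exists_counit _).choose_spec, Subalgebra.coe_add, map_add])
  map_smul' c x := (algebraMap k M).injective (by
    rw [smul_eq_mul, map_mul, (D.exists_counit _).choose_spec, (D.exists_counit _).choose_spec,
      Subalgebra.coe_smul, RingHom.id_apply, ← algebraMap_smul M c (x : B), map_smul,
      smul_eq_mul])

theorem algebraMap_counit (h : D.H) :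
    algebraMap k M (D.counit h) = Coalgebra.counit (R := M) (h : B) :=
  (D.exists_counit h).choose_spec

/-- The antipode of a form. -/
noncomputable def antipode : D.H →ₗ[k] D.H where
  toFun h := ⟨HopfAlgebra.antipode M (h : B), D.antipode_mem h⟩
  map_add' x y := Subtype.ext (by simp)
  map_smul' c x := Subtype.ext (by
    change HopfAlgebra.antipode M ((c • x : D.H) : B) = c • HopfAlgebra.antipode M (x : B)
    rw [Subalgebra.coe_smul, ← algebraMap_smul M c (x : B), map_smul, algebraMap_smul])

theorem coe_antipode (h : D.H) : (D.antipode h : B) = HopfAlgebra.antipode M (h : B) := rfl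

set_option synthInstance.maxHeartbeats 200000 in
theorem incl₃_assoc_rTensor (d : D.H ⊗[k] D.H) :
    D.incl₃ (TensorProduct.assoc k D.H D.H D.H (D.comul.rTensor D.H d)) =
      TensorProduct.assoc M B B B ((Coalgebra.comul (R := M)).rTensor B (D.incl₂ d)) := by
  induction d with
  | zero => simp
  | add d e hd he => simp only [map_add, hd, he]
  | tmul x y =>
    rw [LinearMap.rTensor_tmul, tensorMapOver_tmul, LinearMap.rTensor_tmul]
    change _ = TensorProduct.assoc M B B B (Coalgebra.comul (R := M) (x : B) ⊗ₜ[M] (y : B))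
    rw [← D.incl₂_comul]
    generalize D.comul x = e
    induction e with
    | zero => simp
    | add d e hd he => simp only [map_add, TensorProduct.add_tmul, hd, he]
    | tmul a b => simp

theorem incl₃_lTensor (d : D.H ⊗[k] D.H) :
    D.incl₃ (D.comul.lTensor D.H d) = (Coalgebra.comul (R := M)).lTensor B (D.incl₂ d) := by
  induction d with
  | zero => simp
  | add d e hd he => simp only [map_add, hd, he]
  | tmul x y =>
    rw [LinearMap.lTensor_tmul, tensorMapOver_tmul, tensorMapOver_tmul, LinearMap.lTensor_tmul,
      D.incl₂_comul]
    rfl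

theorem incl_lid_rTensor (d : D.H ⊗[k] D.H) :
    (TensorProduct.lid k D.H (D.counit.rTensor D.H d) : B) =
      TensorProduct.lid M B ((Coalgebra.counit (R := M)).rTensor B (D.incl₂ d)) := by
  induction d with
  | zero => simp
  | add d e hd he => simp only [map_add, Subalgebra.coe_add, hd, he]
  | tmul x y => simp [← D.algebraMap_counit]

theorem incl_rid_lTensor (d : D.H ⊗[k] D.H) :
    (TensorProduct.rid k D.H (D.counit.lTensor D.H d) : B) =
      TensorProduct.rid M B ((Coalgebra.counit (R := M)).lTensor B (D.incl₂ d)) := by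
  induction d with
  | zero => simp
  | add d e hd he => simp only [map_add, Subalgebra.coe_add, hd, he]
  | tmul x y => simp [← D.algebraMap_counit]

noncomputable instance : Coalgebra k D.H where
  comul := D.comul
  counit := D.counit
  coassoc := by
    ext1 h
    refine D.incl₃_injective ?_
    simp only [LinearMap.comp_apply, LinearEquiv.coe_coe]
    rw [incl₃_assoc_rTensor, incl₃_lTensor, D.incl₂_comul, Coalgebra.coassoc_apply]
  rTensor_counit_comp_comul := by
    ext1 h
    refine (TensorProduct.lid k D.H).injective (Subtype.ext ?_)
    rw [LinearMap.comp_apply, incl_lid_rTensor, D.incl₂_comul, Coalgebra.rTensor_counit_comul]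
    simp
  lTensor_counit_comp_comul := by
    ext1 h
    refine (TensorProduct.rid k D.H).injective (Subtype.ext ?_)
    rw [LinearMap.comp_apply, incl_rid_lTensor, D.incl₂_comul, Coalgebra.lTensor_counit_comul]
    simp

theorem incl₂_mul (d e : D.H ⊗[k] D.H) : D.incl₂ (d * e) = D.incl₂ d * D.incl₂ e := by
  induction d with
  | zero => simp
  | add d d' hd hd' => simp only [map_add, add_mul, hd, hd']
  | tmul x y =>
    induction e with
    | zero => simp
    | add e e' he he' => simp only [map_add, mul_add, he, he']
    | tmul a b => simp

noncomputable instance : Bialgebra k D.H :=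
  Bialgebra.mk' k D.H
    ((algebraMap k M).injective (by
      change algebraMap k M (D.counit 1) = _
      rw [D.algebraMap_counit]; simp))
    (fun {a b} => (algebraMap k M).injective (by
      change algebraMap k M (D.counit _) = algebraMap k M (D.counit _ * D.counit _)
      rw [map_mul (algebraMap k M), D.algebraMap_counit, D.algebraMap_counit, D.algebraMap_counit]; simp))
    (D.incl₂_injective (by
      change D.incl₂ (D.comul 1) = _
      rw [D.incl₂_comul, Algebra.TensorProduct.one_def, tensorMapOver_tmul]; simp
      rfl))
    (fun {a b} => D.incl₂_injective (by
      change D.incl₂ (D.comul _) = D.incl₂ (D.comul _ * D.comul _)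
      rw [incl₂_mul, D.incl₂_comul, D.incl₂_comul, D.incl₂_comul]; simp))

theorem incl_mul'_rTensor (d : D.H ⊗[k] D.H) :
    (LinearMap.mul' k D.H (D.antipode.rTensor D.H d) : B) =
      LinearMap.mul' M B ((HopfAlgebra.antipode M).rTensor B (D.incl₂ d)) := by
  induction d with
  | zero => simp
  | add d e hd he => simp only [map_add, Subalgebra.coe_add, hd, he]
  | tmul x y => simp [coe_antipode]

theorem incl_mul'_lTensor (d : D.H ⊗[k] D.H) :
    (LinearMap.mul' k D.H (D.antipode.lTensor D.H d) : B) =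
      LinearMap.mul' M B ((HopfAlgebra.antipode M).lTensor B (D.incl₂ d)) := by
  induction d with
  | zero => simp
  | add d e hd he => simp only [map_add, Subalgebra.coe_add, hd, he]
  | tmul x y => simp [coe_antipode]

noncomputable instance : HopfAlgebra k D.H where
  antipode := D.antipode
  mul_antipode_rTensor_comul := by
    ext1 h
    refine Subtype.ext ?_
    simp only [LinearMap.comp_apply]
    change _ = ((algebraMap k D.H (D.counit h) : D.H) : B)
    rw [incl_mul'_rTensor]
    change LinearMap.mul' M B (LinearMap.rTensor B _ (D.incl₂ (D.comul h))) = _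
    rw [D.incl₂_comul, HopfAlgebra.mul_antipode_rTensor_comul_apply, Subalgebra.coe_algebraMap,
      ← D.algebraMap_counit, ← IsScalarTower.algebraMap_apply]
  mul_antipode_lTensor_comul := by
    ext1 h
    refine Subtype.ext ?_
    simp only [LinearMap.comp_apply]
    change _ = ((algebraMap k D.H (D.counit h) : D.H) : B)
    rw [incl_mul'_lTensor]
    change LinearMap.mul' M B (LinearMap.lTensor B _ (D.incl₂ (D.comul h))) = _
    rw [D.incl₂_comul, HopfAlgebra.mul_antipode_lTensor_comul_apply, Subalgebra.coe_algebraMap,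
      ← D.algebraMap_counit, ← IsScalarTower.algebraMap_apply]

theorem incl₂_comm (d : D.H ⊗[k] D.H) :
    D.incl₂ (TensorProduct.comm k D.H D.H d) = TensorProduct.comm M B B (D.incl₂ d) := by
  induction d with
  | zero => simp
  | add d e hd he => simp only [map_add, hd, he]
  | tmul x y => simp

instance [Coalgebra.IsCocomm M B] : Coalgebra.IsCocomm k D.H where
  comm_comp_comul := by
    ext1 h
    refine D.incl₂_injective ?_
    change D.incl₂ (TensorProduct.comm k D.H D.H (D.comul h)) = D.incl₂ (D.comul h)
    rw [incl₂_comm, D.incl₂_comul, Coalgebra.comm_comul]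

end HopfForm

/-! ### Quadratic twists of group algebras. -/

/-- A quadratic Galois extension `M/k` and an involution of a group `N`. -/
structure QuadraticTwist (k M N : Type*) [Field k] [Field M] [Algebra k M] [Group N] where
  τ : M ≃ₐ[k] M
  τ_τ (m : M) : τ (τ m) = m
  fixed (m : M) : τ m = m → m ∈ (algebraMap k M).range
  θ : M
  τ_θ : τ θ ≠ θ
  σ : N ≃* N
  σ_σ (n : N) : σ (σ n) = n

namespace QuadraticTwist

variable {k M N : Type*} [Field k] [Field M] [Algebra k M] [Group N] (D : QuadraticTwist k M N)

/-- The semilinear involution of the group algebra `M[N]`. -/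
noncomputable def T : MonoidAlgebra M N →ₐ[k] MonoidAlgebra M N :=
  (MonoidAlgebra.mapDomainAlgHom k M (D.σ : N →* N)).comp
    (MonoidAlgebra.mapAlgHom N (D.τ : M →ₐ[k] M))

@[simp]
theorem T_single (n : N) (m : M) :
    D.T (MonoidAlgebra.single n m) = MonoidAlgebra.single (D.σ n) (D.τ m) := by
  simp [T]

theorem T_T (b : MonoidAlgebra M N) : D.T (D.T b) = b := by
  induction b using MonoidAlgebra.induction_linear with
  | zero => simp
  | add b c hb hc => rw [map_add, map_add, hb, hc]
  | single n m => simp [D.τ_τ, D.σ_σ]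

theorem T_smul (m : M) (b : MonoidAlgebra M N) : D.T (m • b) = D.τ m • D.T b := by
  induction b using MonoidAlgebra.induction_linear with
  | zero => simp
  | add b c hb hc => rw [smul_add, map_add, hb, hc, map_add, smul_add]
  | single n m => simp

theorem counit_T (b : MonoidAlgebra M N) :
    Coalgebra.counit (R := M) (D.T b) = D.τ (Coalgebra.counit (R := M) b) := by
  induction b using MonoidAlgebra.induction_linear with
  | zero => simp
  | add b c hb hc => rw [map_add, map_add, hb, hc, map_add, map_add]
  | single n m => simp [MonoidAlgebra.counit_single]

theorem antipode_T (b : MonoidAlgebra M N) :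
    HopfAlgebra.antipode M (D.T b) = D.T (HopfAlgebra.antipode M b) := by
  induction b using MonoidAlgebra.induction_linear with
  | zero => simp
  | add b c hb hc => rw [map_add, map_add, hb, hc, map_add, map_add]
  | single n m => simp [MonoidAlgebra.antipode_single]

/-- The fixed subalgebra of the semilinear involution of `M[N]`. -/
noncomputable def H : Subalgebra k (MonoidAlgebra M N) :=
  AlgHom.equalizer D.T (AlgHom.id k _)

theorem mem_H {b : MonoidAlgebra M N} : b ∈ D.H ↔ D.T b = b := Iff.rfl

theorem T_coe (h : D.H) : D.T (h : MonoidAlgebra M N) = h := h.2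

theorem trace_mem (b : MonoidAlgebra M N) : b + D.T b ∈ D.H := by
  rw [mem_H, map_add, T_T, add_comm]

theorem sub_ne_zero' : D.θ - D.τ D.θ ≠ 0 := sub_ne_zero.2 (Ne.symm D.τ_θ)

/-- Solving `b = x + θ y` and `T b = x + τ(θ) y` forces `y = (b - T b) / (θ - τ θ)`, which is fixed
by `T`. -/
theorem exists_eq_add_smul (b : MonoidAlgebra M N) :
    ∃ x ∈ D.H, ∃ y ∈ D.H, b = x + D.θ • y := by
  have hy : (D.θ - D.τ D.θ)⁻¹ • (b - D.T b) ∈ D.H := by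
    rw [mem_H, T_smul, map_sub, T_T, map_inv₀, map_sub, D.τ_τ, ← neg_sub b, ← neg_sub D.θ, inv_neg,
      smul_neg, neg_smul, neg_neg]
  set y := (D.θ - D.τ D.θ)⁻¹ • (b - D.T b) with hy'
  have hby : b - D.T b = (D.θ - D.τ D.θ) • y := by
    rw [hy', smul_smul, mul_inv_cancel₀ D.sub_ne_zero', one_smul]
  refine ⟨b - D.θ • y, ?_, y, hy, by abel⟩
  rw [mem_H, map_sub, T_smul, D.mem_H.1 hy]
  have hb : b = D.T b + (D.θ - D.τ D.θ) • y := by rw [← hby]; abel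
  clear_value y
  conv_rhs => rw [hb]
  rw [sub_smul]
  abel

theorem exists_scalar (m : M) : ∃ p q : k, m = algebraMap k M p + D.θ * algebraMap k M q := by
  have hq := D.fixed ((D.θ - D.τ D.θ)⁻¹ * (m - D.τ m)) (by
    rw [map_mul, map_sub, D.τ_τ, map_inv₀, map_sub, D.τ_τ, ← neg_sub m, ← neg_sub D.θ, inv_neg]
    ring)
  obtain ⟨q, hq⟩ := hq
  have h0 := D.sub_ne_zero'
  have hm : m - D.τ m = (D.θ - D.τ D.θ) * algebraMap k M q := by
    rw [hq]; field_simp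
  have hp := D.fixed (m - D.θ * algebraMap k M q) (by
    rw [map_sub, map_mul, AlgEquiv.commutes]
    linear_combination -hm)
  obtain ⟨p, hp⟩ := hp
  exact ⟨p, q, by rw [hp]; ring⟩

theorem eq_zero_of_add_smul_eq_zero {x y : MonoidAlgebra M N} (hx : x ∈ D.H) (hy : y ∈ D.H)
    (h : x + D.θ • y = 0) : x = 0 ∧ y = 0 := by
  have h2 := congrArg D.T h
  rw [map_add, T_smul, D.mem_H.1 hx, D.mem_H.1 hy, map_zero] at h2
  have h3 : (D.θ - D.τ D.θ) • y = 0 := by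
    rw [sub_smul, ← add_sub_add_left_eq_sub _ _ x, h, h2, sub_zero]
  have hy0 : y = 0 := (smul_eq_zero.1 h3).resolve_left D.sub_ne_zero'
  subst hy0
  simpa using h

/-- Writing each coefficient as `p + θ q` with `p, q ∈ k` splits a relation over `M` into two
relations over `k`. -/
theorem linearIndependent_basis {ι : Type*} (b : Module.Basis ι k D.H) :
    LinearIndependent M (fun i => (b i : MonoidAlgebra M N)) := by
  rw [linearIndependent_iff']
  intro s g hg
  choose p q hpq using D.exists_scalar
  have key : ∀ f : M → k, ((∑ i ∈ s, f (g i) • b i : D.H) : MonoidAlgebra M N) =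
      ∑ i ∈ s, algebraMap k M (f (g i)) • (b i : MonoidAlgebra M N) := fun f => by
    rw [AddSubmonoidClass.coe_finsetSum]
    exact Finset.sum_congr rfl fun i _ => by rw [Subalgebra.coe_smul, algebraMap_smul]
  obtain ⟨h1, h2⟩ := D.eq_zero_of_add_smul_eq_zero (∑ i ∈ s, p (g i) • b i).2
    (∑ i ∈ s, q (g i) • b i).2 (by
      rw [key, key, Finset.smul_sum, ← Finset.sum_add_distrib, ← hg]
      exact Finset.sum_congr rfl fun i _ => by rw [smul_smul, ← add_smul, ← hpq])
  have hb := linearIndependent_iff'.1 b.linearIndependent s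
  have h1' := hb (fun i => p (g i)) (Subtype.ext h1)
  have h2' := hb (fun i => q (g i)) (Subtype.ext h2)
  intro i hi
  rw [hpq (g i), h1' i hi, h2' i hi]
  simp

theorem span_basis {ι : Type*} (b : Module.Basis ι k D.H) :
    Submodule.span M (Set.range fun i => (b i : MonoidAlgebra M N)) = ⊤ := by
  have hH : ∀ x ∈ D.H, x ∈ Submodule.span M (Set.range fun i => (b i : MonoidAlgebra M N)) := by
    intro x hx
    have h1 : (⟨x, hx⟩ : D.H) ∈ Submodule.span k (Set.range b) := by rw [b.span_eq]; trivial
    have h2 := Submodule.mem_map_of_mem (f := D.H.val.toLinearMap) h1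
    rw [Submodule.map_span, ← Set.range_comp] at h2
    exact Submodule.span_le_restrictScalars k M _ h2
  rw [eq_top_iff]
  intro x _
  obtain ⟨y, hy, z, hz, rfl⟩ := D.exists_eq_add_smul x
  exact Submodule.add_mem _ (hH y hy) (Submodule.smul_mem _ _ (hH z hz))

/-- A `k`-basis of the fixed subalgebra is an `M`-basis of `M[N]`. -/
noncomputable def basisOver {ι : Type*} (b : Module.Basis ι k D.H) :
    Module.Basis ι M (MonoidAlgebra M N) :=
  Module.Basis.mk (D.linearIndependent_basis b) (D.span_basis b).ge

theorem basisOver_apply {ι : Type*} (b : Module.Basis ι k D.H) (i : ι) :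
    D.basisOver b i = b i := by simp [basisOver]

/-- A `k`-basis of `H` and the group elements are two `M`-bases of `M[N]`; `κ` is the matrix of the
change of basis. -/
theorem exists_dual_coeff [Fintype N] {ι : Type*} [DecidableEq ι] (b : Module.Basis ι k D.H) :
    ∃ κ : ι → N → M, ∀ i j,
      ∑ n, (b j : MonoidAlgebra M N).coeff n * κ i n = if j = i then 1 else 0 := by
  refine ⟨fun i n => (D.basisOver b).coord i (MonoidAlgebra.single n 1), fun i j => ?_⟩
  have h : ∀ x : MonoidAlgebra M N, (D.basisOver b).coord i x =
      ∑ n, x.coeff n * (D.basisOver b).coord i (MonoidAlgebra.single n 1) := by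
    intro x
    induction x using MonoidAlgebra.induction_linear with
    | zero => simp
    | add x y hx hy =>
      rw [map_add, hx, hy, ← Finset.sum_add_distrib]
      simp [add_mul]
    | single n m =>
      classical
      rw [Finset.sum_eq_single n]
      · rw [MonoidAlgebra.coeff_single, Finsupp.single_eq_same, ← smul_eq_mul, ← map_smul]
        simp
      · intro n' _ hn'
        simp [Finsupp.single_eq_of_ne hn']
      · simp
  rw [← h, ← D.basisOver_apply b j, Module.Basis.coord_apply, Module.Basis.repr_self,
    Finsupp.single_apply]

/-- Every element of `H` is a trace `b + T b`, so it suffices to treat traces of `m n` with `n` in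
the group. With `n = x + θ y` and `σ n = x + τ(θ) y`, the coefficients of the comultiplication in `x
⊗ x`, `x ⊗ y + y ⊗ x`, `y ⊗ y` are traces from `M`, hence in `k`. -/
theorem exists_comul (h : D.H) : ∃ d : D.H ⊗[k] D.H,
    tensorMapOver M D.H.val.toLinearMap D.H.val.toLinearMap d =
      Coalgebra.comul (R := M) (h : MonoidAlgebra M N) := by
  set ι₂ := tensorMapOver M D.H.val.toLinearMap D.H.val.toLinearMap with hι
  suffices hT : ∀ b : MonoidAlgebra M N,
      Coalgebra.comul (R := M) (b + D.T b) ∈ LinearMap.range ι₂ by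
    -- The scalar `θ / (θ - τ θ)` has trace one.
    have := hT ((D.θ * (D.θ - D.τ D.θ)⁻¹) • (h : MonoidAlgebra M N))
    rw [T_smul, T_coe, ← add_smul] at this
    rw [← LinearMap.mem_range]
    convert this
    have h0 := D.sub_ne_zero'
    have h1 : D.θ * (D.θ - D.τ D.θ)⁻¹ + D.τ (D.θ * (D.θ - D.τ D.θ)⁻¹) = 1 := by
      rw [map_mul, map_inv₀, map_sub, D.τ_τ, ← neg_sub D.θ, inv_neg]
      field_simp
      ring
    rw [h1, one_smul]
  intro b
  induction b using MonoidAlgebra.induction_linear with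
  | zero => simp
  | add b c hb hc =>
    rw [map_add D.T, add_add_add_comm, map_add]
    exact Submodule.add_mem _ hb hc
  | single n m =>
    obtain ⟨x, hx, y, hy, hxy⟩ := D.exists_eq_add_smul (MonoidAlgebra.single n (1 : M))
    have hxy' : MonoidAlgebra.single (D.σ n) (1 : M) = x + D.τ D.θ • y := by
      have := congrArg D.T hxy
      rwa [T_single, map_one, map_add, T_smul, D.mem_H.1 hx, D.mem_H.1 hy] at this
    have hc : ∀ (n : N) (m : M), Coalgebra.comul (R := M) (MonoidAlgebra.single n m) =
        m • (MonoidAlgebra.single n (1 : M) ⊗ₜ[M] MonoidAlgebra.single n (1 : M)) := by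
      intro n m
      rw [MonoidAlgebra.comul_single, CommSemiring.comul_apply, TensorProduct.map_tmul,
        TensorProduct.smul_tmul', MonoidAlgebra.smul_single, smul_eq_mul, mul_one]
      have e : MonoidAlgebra.single n m = m • MonoidAlgebra.single n (1 : M) := by simp
      change MonoidAlgebra.single n (1 : M) ⊗ₜ[M] MonoidAlgebra.single n m = _
      rw [e, TensorProduct.tmul_smul, TensorProduct.smul_tmul']
    rw [T_single, map_add, hc, hc, hxy, hxy']
    have htr : ∀ a : M, ∃ c : k, algebraMap k M c = a + D.τ a := fun a =>
      D.fixed _ (by rw [map_add, D.τ_τ, add_comm])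
    obtain ⟨c₀, h₀⟩ := htr m
    obtain ⟨c₁, h₁⟩ := htr (m * D.θ)
    obtain ⟨c₂, h₂⟩ := htr (m * D.θ * D.θ)
    let X : D.H := ⟨x, hx⟩
    let Y : D.H := ⟨y, hy⟩
    refine ⟨c₀ • (X ⊗ₜ X) + c₁ • (X ⊗ₜ Y + Y ⊗ₜ X) + c₂ • (Y ⊗ₜ Y), ?_⟩
    simp only [map_add, map_smul, hι, tensorMapOver_tmul]
    rw [← algebraMap_smul M c₀, ← algebraMap_smul M c₁, ← algebraMap_smul M c₂, h₀, h₁, h₂]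
    simp only [map_mul, TensorProduct.add_tmul, TensorProduct.tmul_add, TensorProduct.tmul_smul,
      ← TensorProduct.smul_tmul']
    change (m + D.τ m) • (x ⊗ₜ[M] x) + (m * D.θ + D.τ m * D.τ D.θ) • (x ⊗ₜ[M] y + y ⊗ₜ[M] x) +
      (m * D.θ * D.θ + D.τ m * D.τ D.θ * D.τ D.θ) • (y ⊗ₜ[M] y) = _
    module

/-- The fixed subalgebra of `M[N]`, as a form of the Hopf algebra `M[N]`. -/
noncomputable def form : HopfForm k M (MonoidAlgebra M N) where
  H := D.H
  ι := Module.Basis.ofVectorSpaceIndex k D.H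
  basis := Module.Basis.ofVectorSpace k D.H
  indep := D.linearIndependent_basis _
  exists_comul := D.exists_comul
  exists_counit h := D.fixed _ (by rw [← counit_T, T_coe])
  antipode_mem h := by rw [mem_H, ← antipode_T, T_coe]

theorem finite_H [Finite N] : Module.Finite k D.H := by
  let b := Module.Basis.ofVectorSpace k D.H
  have : Module.Finite M (MonoidAlgebra M N) := Module.Finite.of_basis (MonoidAlgebra.basis N M)
  have : Finite (Module.Basis.ofVectorSpaceIndex k D.H) := Module.Finite.finite_basis (D.basisOver b)
  exact Module.Finite.of_basis b

theorem finrank_H : Module.finrank k D.H = Nat.card N := by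
  let b := Module.Basis.ofVectorSpace k D.H
  rw [Module.finrank_eq_nat_card_basis b, ← Module.finrank_eq_nat_card_basis (D.basisOver b),
    Module.finrank_eq_nat_card_basis (MonoidAlgebra.basis N M)]

end QuadraticTwist

theorem eq_zero_of_sum_mul_eq_zero {M L N ι : Type*} [Field M] [Field L] [Fintype N] [Fintype ι]
    [DecidableEq ι] (f : M →+* L) {A : ι → N → M} {κ : ι → N → M}
    (hκ : ∀ i j, ∑ n, A j n * κ i n = if j = i then 1 else 0) {c : ι → L}
    (hc : ∀ n, ∑ i, c i * f (A i n) = 0) (i : ι) : c i = 0 := by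
  have h : ∑ n, (∑ j, c j * f (A j n)) * f (κ i n) = ∑ j, c j * f (∑ n, A j n * κ i n) := by
    simp only [Finset.sum_mul, map_sum, Finset.mul_sum]
    rw [Finset.sum_comm]
    refine Finset.sum_congr rfl fun j _ => Finset.sum_congr rfl fun n _ => ?_
    rw [map_mul, mul_assoc]
  simpa [hc, hκ] using h.symm

/-! ### Hopf Galois structures from normal complements of an involution. -/

/-- An involution `t` of a Galois extension `L/k`, with fixed field `F`, and a normal complement
`N` of the group it generates. -/
structure InvolutionComplement (k : Type u) (L : Type v) [Field k] [Field L] [Algebra k L]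
    (F : IntermediateField k L) (t : Gal(L/k)) where
  N : Subgroup Gal(L/k)
  normal : N.Normal
  notMem : t ∉ N
  mem_or (g : Gal(L/k)) : g ∈ N ∨ g * t ∈ N
  mul_self : t * t = 1
  mem_fixing (g : Gal(L/k)) : g ∈ F.fixingSubgroup ↔ g = 1 ∨ g = t

namespace InvolutionComplement

variable {k : Type u} {L : Type v} [Field k] [Field L] [Algebra k L] [FiniteDimensional k L]
  [IsGalois k L] {F : IntermediateField k L} {t : Gal(L/k)} (C : InvolutionComplement k L F t)

/-- The quadratic field fixed by the complement. -/
abbrev M : IntermediateField k L := IntermediateField.fixedField C.N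

instance : C.N.Normal := C.normal

instance : IsGalois k C.M := IsGalois.of_fixedField_normal_subgroup C.N

theorem apply_coe_M {n : Gal(L/k)} (hn : n ∈ C.N) (m : C.M) : n (m : L) = m := m.2 ⟨n, hn⟩

theorem apply_apply (C : InvolutionComplement k L F t) (x : L) : t (t x) = x := by
  have := congr($C.mul_self x)
  simpa using this

theorem mem_F_iff (C : InvolutionComplement k L F t) (x : L) : x ∈ F ↔ t x = x := by
  conv_lhs => rw [← IsGalois.fixedField_fixingSubgroup F]
  constructor
  · intro hx
    exact hx ⟨t, (C.mem_fixing t).2 (Or.inr rfl)⟩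
  · rintro hx ⟨g, hg⟩
    rcases (C.mem_fixing g).1 hg with rfl | rfl
    · rfl
    · exact hx

theorem coe_restrictNormal (m : C.M) : ((t.restrictNormal C.M m : C.M) : L) = t m :=
  AlgEquiv.restrictNormal_commutes t C.M m

theorem exists_moved : ∃ m : C.M, t.restrictNormal C.M m ≠ m := by
  by_contra! h
  refine C.notMem ?_
  rw [← IntermediateField.fixingSubgroup_fixedField C.N, IntermediateField.mem_fixingSubgroup_iff]
  intro x hx
  have := congrArg Subtype.val (h ⟨x, hx⟩)
  rwa [coe_restrictNormal] at this

/-- The twisted group algebra attached to a complement. -/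
noncomputable def twist : QuadraticTwist k C.M C.N where
  τ := t.restrictNormal C.M
  τ_τ m := Subtype.ext (by rw [coe_restrictNormal, coe_restrictNormal, C.apply_apply])
  fixed m hm := by
    have h1 : (m : L) ∈ Set.range (algebraMap k L) := by
      rw [IsGalois.mem_range_algebraMap_iff_fixed]
      have ht : t (m : L) = m := by rw [← coe_restrictNormal, hm]
      intro g
      rcases C.mem_or g with hg | hg
      · exact C.apply_coe_M hg m
      · have := C.apply_coe_M hg m
        rwa [AlgEquiv.mul_apply, ht] at this
    obtain ⟨c, hc⟩ := h1
    exact ⟨c, Subtype.ext hc⟩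
  θ := C.exists_moved.choose
  τ_θ := C.exists_moved.choose_spec
  σ := MulAut.conjNormal t
  σ_σ n := Subtype.ext (by
    have h : t⁻¹ = t := inv_eq_of_mul_eq_one_left C.mul_self
    rw [MulAut.conjNormal_apply, MulAut.conjNormal_apply, h]
    calc t * (t * n * t) * t = (t * t) * n * (t * t) := by group
      _ = n := by rw [C.mul_self, one_mul, mul_one])

theorem coe_τ (m : C.M) : ((C.twist.τ m : C.M) : L) = t m := C.coe_restrictNormal m

theorem coe_σ (n : C.N) : ((C.twist.σ n : C.N) : Gal(L/k)) = t * n * t⁻¹ :=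
  MulAut.conjNormal_apply t n

/-- The complement acts on `L`, linearly over its fixed field. -/
def rep : C.N →* Module.End C.M L where
  toFun n :=
    { toFun := fun x => (n : Gal(L/k)) x
      map_add' := map_add _
      map_smul' := fun m x => by
        rw [Algebra.smul_def, map_mul, RingHom.id_apply, Algebra.smul_def]
        congr 1
        exact C.apply_coe_M n.2 m }
  map_one' := rfl
  map_mul' _ _ := rfl

/-- The action of the group algebra on `L`. -/
noncomputable def opL : MonoidAlgebra C.M C.N →ₐ[C.M] Module.End C.M L :=
  MonoidAlgebra.lift C.M (Module.End C.M L) C.N C.rep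

theorem opL_single (n : C.N) (m : C.M) (x : L) :
    C.opL (MonoidAlgebra.single n m) x = m * (n : Gal(L/k)) x := by
  rw [opL, MonoidAlgebra.lift_single, LinearMap.smul_apply, Algebra.smul_def]; rfl

/-- This is why the elements fixed by `T` preserve `F`, the fixed field of `t`. -/
theorem opL_T (b : MonoidAlgebra C.M C.N) (x : L) :
    C.opL (C.twist.T b) (t x) = t (C.opL b x) := by
  induction b using MonoidAlgebra.induction_linear with
  | zero => simp
  | add b c hb hc => simp only [map_add, LinearMap.add_apply, hb, hc]
  | single n m =>
    rw [QuadraticTwist.T_single, opL_single, opL_single, map_mul, coe_τ, coe_σ]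
    congr 1
    rw [AlgEquiv.mul_apply, AlgEquiv.mul_apply]
    congr 2
    exact t.symm_apply_apply x

theorem opL_one (b : MonoidAlgebra C.M C.N) :
    C.opL b 1 = ((Coalgebra.counit (R := C.M) b : C.M) : L) := by
  induction b using MonoidAlgebra.induction_linear with
  | zero => simp
  | add b c hb hc => simp only [map_add, LinearMap.add_apply, hb, hc, IntermediateField.coe_add]
  | single n m => rw [opL_single, MonoidAlgebra.counit_single]; simp

/-- `a ⊗ b ↦ (a x) (b y)`. -/
noncomputable def mulOp (x y : L) :
    MonoidAlgebra C.M C.N ⊗[C.M] MonoidAlgebra C.M C.N →ₗ[C.M] L :=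
  LinearMap.mul' C.M L ∘ₗ
    TensorProduct.map (C.opL.toLinearMap.flip x) (C.opL.toLinearMap.flip y)

theorem mulOp_tmul (x y : L) (a b : MonoidAlgebra C.M C.N) :
    C.mulOp x y (a ⊗ₜ b) = C.opL a x * C.opL b y := by
  simp [mulOp]

theorem mulOp_comul (x y : L) (b : MonoidAlgebra C.M C.N) :
    C.mulOp x y (Coalgebra.comul (R := C.M) b) = C.opL b (x * y) := by
  induction b using MonoidAlgebra.induction_linear with
  | zero => simp
  | add b c hb hc => simp only [map_add, LinearMap.add_apply, hb, hc]
  | single n m =>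
    rw [MonoidAlgebra.comul_single, CommSemiring.comul_apply, TensorProduct.map_tmul, mulOp_tmul]
    change C.opL (MonoidAlgebra.single n 1) x * C.opL (MonoidAlgebra.single n m) y = _
    rw [opL_single, opL_single, opL_single, map_mul, OneMemClass.coe_one]
    ring

theorem opL_eq_sum [Fintype C.N] (b : MonoidAlgebra C.M C.N) (x : L) :
    C.opL b x = ∑ n : C.N, (b.coeff n : L) * (n : Gal(L/k)) x := by
  classical
  induction b using MonoidAlgebra.induction_linear with
  | zero => simp
  | add b c hb hc =>
    simp only [map_add, LinearMap.add_apply, hb, hc, MonoidAlgebra.coeff_add, Finsupp.add_apply,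
      IntermediateField.coe_add, add_mul, Finset.sum_add_distrib]
  | single n m =>
    rw [opL_single, Finset.sum_eq_single n]
    · simp
    · intro n' _ hn'
      simp [Finsupp.single_eq_of_ne hn']
    · simp

theorem opL_mem (h : C.twist.form.H) (x : F) : C.opL (h : MonoidAlgebra C.M C.N) x ∈ F := by
  rw [C.mem_F_iff, ← opL_T, (C.mem_F_iff x).1 x.2]
  congr 2
  exact C.twist.T_coe h

/-- The action of the twisted group algebra on `F`. -/
noncomputable def act : C.twist.form.H →ₐ[k] Module.End k F where
  toFun h :=
    { toFun := fun x => ⟨C.opL (h : MonoidAlgebra C.M C.N) x, C.opL_mem h x⟩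
      map_add' := fun x y => Subtype.ext (by simp)
      map_smul' := fun c x => Subtype.ext (by
        change C.opL (h : MonoidAlgebra C.M C.N) (c • (x : L)) = c • C.opL _ (x : L)
        rw [← algebraMap_smul C.M c (x : L), map_smul, algebraMap_smul]) }
  map_one' := by ext x; simp
  map_mul' h h' := by ext x; simp
  map_zero' := by ext x; simp
  map_add' h h' := by ext x; simp
  commutes' c := by
    ext x
    change C.opL (algebraMap k (MonoidAlgebra C.M C.N) c) (x : L) =
      ((algebraMap k (Module.End k F) c x : F) : L)
    rw [IsScalarTower.algebraMap_apply k C.M (MonoidAlgebra C.M C.N), AlgHom.commutes]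
    simp [Module.algebraMap_end_apply]

theorem coe_act (h : C.twist.form.H) (x : F) :
    ((C.act h x : F) : L) = C.opL (h : MonoidAlgebra C.M C.N) x := rfl

theorem coe_mul'_act (x y : F) (d : C.twist.form.H ⊗[k] C.twist.form.H) :
    ((LinearMap.mul' k F (TensorProduct.map (C.act.toLinearMap.flip x) (C.act.toLinearMap.flip y)
      d) : F) : L) = C.mulOp x y (C.twist.form.incl₂ d) := by
  induction d with
  | zero => simp
  | add d e hd he => simp only [map_add, IntermediateField.coe_add, hd, he]
  | tmul a b =>
    rw [tensorMapOver_tmul, mulOp_tmul, TensorProduct.map_tmul, LinearMap.mul'_apply]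
    rfl

/-- The embedding of `F` given by an automorphism of `L`. -/
def res (F : IntermediateField k L) (g : Gal(L/k)) : F →ₐ[k] L := (g : L →ₐ[k] L).comp F.val

/-- The embedding of `F` given by an element of the complement. -/
def emb (n : C.N) : F →ₐ[k] L := res F (n : Gal(L/k))

theorem emb_injective : Function.Injective C.emb := by
  intro n n' h
  have h1 : (n' : Gal(L/k))⁻¹ * n ∈ F.fixingSubgroup := by
    rw [IntermediateField.mem_fixingSubgroup_iff]
    intro x hx
    have := congr($h ⟨x, hx⟩)
    change (n : Gal(L/k)) x = (n' : Gal(L/k)) x at this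
    rw [AlgEquiv.mul_apply, this]
    exact (n' : Gal(L/k)).symm_apply_apply x
  rcases (C.mem_fixing _).1 h1 with h2 | h2
  · exact (Subtype.ext (inv_mul_eq_one.1 h2)).symm
  · exact (C.notMem ((congrArg (· ∈ C.N) h2).mp (C.N.mul_mem (C.N.inv_mem n'.2) n.2))).elim

/-- The complement restricts to distinct embeddings of `F`. Their independence isolates the
coefficient of each group element, and the dual matrix `κ` then isolates each `c i`. -/
theorem eq_zero_of_sum_mul_act {ι : Type*} [Fintype ι] (b : Module.Basis ι k C.twist.form.H)
    (c : ι → F) (h : ∀ x : F, ∑ i, (c i : L) * C.opL (b i : MonoidAlgebra C.M C.N) x = 0) (i : ι) :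
    c i = 0 := by
  classical
  have : Fintype C.N := Fintype.ofFinite _
  obtain ⟨κ, hκ⟩ := C.twist.exists_dual_coeff b
  have h1 : ∀ x : F, ∑ n : C.N, (∑ i, (c i : L) * ((b i : MonoidAlgebra C.M C.N).coeff n : L)) *
      (n : Gal(L/k)) x = 0 := by
    intro x
    have h2 := h x
    simp only [opL_eq_sum, Finset.mul_sum] at h2
    rw [Finset.sum_comm] at h2
    simp only [Finset.sum_mul, mul_assoc]
    exact h2
  have h2 : ∀ n : C.N, ∑ i, (c i : L) * ((b i : MonoidAlgebra C.M C.N).coeff n : L) = 0 := by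
    have hli := (linearIndependent_toLinearMap k F L).comp _ C.emb_injective
    rw [Fintype.linearIndependent_iff] at hli
    refine hli _ ?_
    ext x
    simpa [emb, res] using h1 x
  exact Subtype.ext (eq_zero_of_sum_mul_eq_zero (algebraMap C.M L) hκ h2 i)

theorem hopfGaloisMap_injective : Function.Injective (hopfGaloisMap C.act) := by
  have : Module.Finite k C.twist.form.H := C.twist.finite_H
  let b : Module.Basis _ k C.twist.form.H := Module.finBasis k C.twist.form.H
  rw [injective_iff_map_eq_zero]
  intro d hd
  let B : Module.Basis _ F (F ⊗[k] C.twist.form.H) := Algebra.TensorProduct.basis F b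
  obtain ⟨c, hc⟩ : ∃ c : _ → F, d = ∑ i, c i ⊗ₜ[k] b i := by
    refine ⟨fun i => B.repr d i, ?_⟩
    conv_lhs => rw [← B.sum_repr d]
    refine Finset.sum_congr rfl fun i _ => ?_
    rw [Algebra.TensorProduct.basis_apply, TensorProduct.smul_tmul', smul_eq_mul, mul_one]
  have h1 : ∀ x : F, ∑ i, (c i : L) * C.opL (b i : MonoidAlgebra C.M C.N) x = 0 := by
    intro x
    have h2 : ((hopfGaloisMap C.act d x : F) : L) = 0 := by rw [hd]; rfl
    rw [hc, map_sum, LinearMap.sum_apply, AddSubmonoidClass.coe_finsetSum] at h2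
    simp only [hopfGaloisMap_tmul] at h2
    exact h2
  rw [hc]
  exact Finset.sum_eq_zero fun i _ => by
    rw [C.eq_zero_of_sum_mul_act b c h1 i, TensorProduct.zero_tmul]

/-- The Hopf Galois structure attached to a normal complement. -/
noncomputable def hopfGaloisStructure (hF : Module.finrank k F = Nat.card C.N) :
    HopfGaloisStructure k F where
  H := C.twist.form.H
  finite := C.twist.finite_H
  act := C.act
  act_one h := Subtype.ext (by
    rw [coe_act]
    refine (C.opL_one _).trans ?_
    rw [← C.twist.form.algebraMap_counit]
    rfl)
  act_mul h x y := Subtype.ext (by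
    rw [coe_mul'_act, coe_act]
    change _ = C.mulOp x y (C.twist.form.incl₂ (C.twist.form.comul h))
    rw [C.twist.form.incl₂_comul, mulOp_comul]
    rfl)
  bijective := by
    have : Module.Finite k C.twist.form.H := C.twist.finite_H
    refine ⟨C.hopfGaloisMap_injective, ?_⟩
    refine (LinearMap.injective_iff_surjective_of_finrank_eq_finrank ?_).1
      C.hopfGaloisMap_injective
    rw [Module.finrank_tensorProduct, Module.finrank_linearMap, hF]
    congr 1
    exact C.twist.finrank_H

theorem coeff_eq_of_act_eq (C' : InvolutionComplement k L F t) {h : C.twist.form.H}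
    {h' : C'.twist.form.H} (hh : ∀ x : F, C.act h x = C'.act h' x) {n : C.N} {n' : C'.N}
    (hn : C.emb n = C'.emb n') :
    ((h : MonoidAlgebra C.M C.N).coeff n : L) =
      ((h' : MonoidAlgebra C'.M C'.N).coeff n' : L) := by
  classical
  have key : ∀ (E : InvolutionComplement k L F t) [Fintype E.N] (a : E.N → L) (x : F),
      ∑ n, a n * (n : Gal(L/k)) x =
        ∑ y : F →ₐ[k] L, (∑ n with E.emb n = y, a n) * y x := by
    intro E _ a x
    rw [← Finset.sum_fiberwise (s := Finset.univ) (g := E.emb)]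
    refine Finset.sum_congr rfl fun y _ => ?_
    rw [Finset.sum_mul]
    refine Finset.sum_congr rfl fun n hn => ?_
    rw [← (Finset.mem_filter.1 hn).2]
    rfl
  have hsingle : ∀ (E : InvolutionComplement k L F t) [Fintype E.N] (a : E.N → L) (n : E.N),
      (∑ m with E.emb m = E.emb n, a m) = a n := by
    intro E _ a n
    rw [Finset.sum_eq_single_of_mem n (by simp)]
    intro m hm hmn
    exact absurd (E.emb_injective (Finset.mem_filter.1 hm).2) hmn
  have : Fintype C.N := Fintype.ofFinite _
  have : Fintype C'.N := Fintype.ofFinite _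
  have h1 := GreitherPareigis.eq_of_sum_mul_eq (k := k) (F := F) (L := L)
    (f := fun y => ∑ m with C.emb m = y,
      ((h : MonoidAlgebra C.M C.N).coeff m : L))
    (g := fun y => ∑ m with C'.emb m = y,
      ((h' : MonoidAlgebra C'.M C'.N).coeff m : L)) (fun x => by
        rw [← key C, ← key C', ← opL_eq_sum, ← opL_eq_sum]
        exact congrArg Subtype.val (hh x))
  have h2 := congr_fun h1 (C.emb n)
  rw [hsingle C] at h2
  rw [h2, hn, hsingle C']

/-- The action on `F` determines the coefficients in `L`, which lie in `C.M` for one structure and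
in `C'.M` for the other. An operator with coefficient `θ` at some embedding would give `θ ∈ C.M ∩
C'.M`; but this intersection is fixed by `t`, and `θ` is not. -/
theorem not_equivalent (C' : InvolutionComplement k L F t) (hne : C.N ≠ C'.N)
    (hF : Module.finrank k F = Nat.card C.N) (hF' : Module.finrank k F = Nat.card C'.N)
    {n : Gal(L/k)} (hn : n ∈ C.N) (hnt : n * t ≠ t * n) :
    ¬ (C.hopfGaloisStructure hF).Equivalent (C'.hopfGaloisStructure hF') := by
  rintro ⟨φ, hφ⟩
  let n₁ : C.N := ⟨n, hn⟩
  -- As `n` does not commute with `t`, the two terms of the trace of `θ n` sit at different group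
  -- elements, so the coefficient at `n` is `θ` itself.
  let b : MonoidAlgebra C.M C.N := MonoidAlgebra.single n₁ C.twist.θ
  let h : C.twist.form.H := ⟨b + C.twist.T b, C.twist.trace_mem b⟩
  let h' : C'.twist.form.H := φ h
  have hh : ∀ x : F, C.act h x = C'.act h' x := fun x => congr($((hφ h).symm) x)
  have hσ : C.twist.σ n₁ ≠ n₁ := by
    intro e
    have := congrArg Subtype.val e
    rw [coe_σ] at this
    exact hnt (mul_inv_eq_iff_eq_mul.1 this).symm
  have hcoeff : (h : MonoidAlgebra C.M C.N).coeff n₁ = C.twist.θ := by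
    change (b + C.twist.T b).coeff n₁ = _
    rw [QuadraticTwist.T_single, MonoidAlgebra.coeff_add, Finsupp.add_apply,
      MonoidAlgebra.coeff_single, MonoidAlgebra.coeff_single, Finsupp.single_eq_same,
      Finsupp.single_eq_of_ne (Ne.symm hσ), add_zero]
  have hθ : (C.twist.θ : L) ∈ C'.M := by
    obtain ⟨n', hn'⟩ : ∃ n' : C'.N, C.emb n₁ = C'.emb n' := by
      rcases C'.mem_or n with h1 | h1
      · exact ⟨⟨n, h1⟩, rfl⟩
      · refine ⟨⟨n * t, h1⟩, ?_⟩
        ext x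
        change n x = n (t x)
        rw [(C.mem_F_iff x).1 x.2]
    have := C.coeff_eq_of_act_eq C' hh (n := n₁) hn'
    rw [hcoeff] at this
    rw [this]
    exact SetLike.coe_mem _
  have hfix : ∀ g ∈ C'.N, g (C.twist.θ : L) = C.twist.θ := fun g hg => hθ ⟨g, hg⟩
  -- Both `g ∈ C'.N` and `g * t ∈ C.N` fix `θ`, hence so does `t`.
  obtain ⟨g, hg, hg'⟩ : ∃ g ∈ C'.N, g ∉ C.N := by
    by_contra! hle
    refine hne (le_antisymm (fun g hg => ?_) hle)
    refine (C'.mem_or g).resolve_right fun h1 => C.notMem ?_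
    exact (C.N.mul_mem_cancel_left hg).1 (hle _ h1)
  have h1 := C.apply_coe_M ((C.mem_or g).resolve_left hg') C.twist.θ
  have h2 : t (C.twist.θ : L) = C.twist.θ := by
    refine g.injective ?_
    rw [hfix g hg]
    exact h1
  exact C.twist.τ_θ (Subtype.ext (by rw [coe_τ, h2]))

/-- A normal complement of `⟨t⟩` is also a complement of each conjugate of `⟨t⟩`, that is, of every
point stabilizer; so its image is simply transitive. -/
theorem isAlmostClassicallyGalois (C : InvolutionComplement k L F t) : IsAlmostClassicallyGalois k F := by
  refine ⟨C.N.map (cosetAction F.fixingSubgroup), ?_, ?_, ?_⟩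
  · intro x y
    induction x using QuotientGroup.induction_on with | _ x
    induction y using QuotientGroup.induction_on with | _ y
    have hmul : ∀ n a : Gal(L/k), cosetAction F.fixingSubgroup n (a : Gal(L/k) ⧸ F.fixingSubgroup) =
        ((n * a : Gal(L/k)) : Gal(L/k) ⧸ F.fixingSubgroup) := fun _ _ => rfl
    have heq : ∀ a b : Gal(L/k), (a : Gal(L/k) ⧸ F.fixingSubgroup) = b ↔ b = a ∨ b = a * t := by
      intro a b
      rw [QuotientGroup.eq, C.mem_fixing, inv_mul_eq_one, inv_mul_eq_iff_eq_mul]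
      exact or_congr_left eq_comm
    obtain ⟨n, hn, hny⟩ : ∃ n ∈ C.N, y = n * x ∨ y = n * x * t := by
      rcases C.mem_or (x⁻¹ * y) with h | h
      · exact ⟨x * (x⁻¹ * y) * x⁻¹, C.normal.conj_mem _ h x, Or.inl (by group)⟩
      · refine ⟨x * (x⁻¹ * y * t) * x⁻¹, C.normal.conj_mem _ h x, Or.inr ?_⟩
        have : x * (x⁻¹ * y * t) * x⁻¹ * x * t = y * (t * t) := by group
        rw [this, C.mul_self, mul_one]
    refine ⟨cosetAction F.fixingSubgroup n, ⟨⟨n, hn, rfl⟩, ?_⟩, ?_⟩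
    · rw [hmul, heq]
      exact hny
    · rintro _ ⟨⟨m, hm, rfl⟩, hmy⟩
      congr 1
      have h1 : (m * x : Gal(L/k)) = (n * x : Gal(L/k)) ∨ (m * x : Gal(L/k)) = n * x * t := by
        exact (heq _ _).1 (((heq _ _).2 hny).trans (hmy.symm.trans (hmul m x)))
      rcases h1 with h1 | h1
      · exact mul_right_cancel h1
      · exfalso
        have h2 : x⁻¹ * (n⁻¹ * m) * x = t := by
          have : m = n * x * t * x⁻¹ := by rw [← h1]; group
          rw [this]; group
        refine C.notMem ((congrArg (· ∈ C.N) h2).mp ?_)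
        simpa using C.normal.conj_mem _ (C.N.mul_mem (C.N.inv_mem hn) hm) x⁻¹
  · rintro g _ ⟨n, hn, rfl⟩
    exact ⟨g * n * g⁻¹, C.normal.conj_mem n hn g, by simp⟩
  · rintro _ ⟨n, -, rfl⟩
    exact ⟨n, rfl⟩

end InvolutionComplement

/-! ### Galois closures, embeddings and fixing subgroups. -/

section Facts

variable {k : Type u} {L : Type v} [Field k] [Field L] [Algebra k L]

open IntermediateField

theorem normalClosure_eq_top (K : IntermediateField k L) [IsNormalClosure k K L] :
    normalClosure k K L = ⊤ := by
  have : Normal k L := IsNormalClosure.normal (K := K)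
  rw [normalClosure_eq_iSup_adjoin]
  exact IsNormalClosure.adjoin_rootSet

theorem finiteDimensional_of_isNormalClosure (K : IntermediateField k L) [IsNormalClosure k K L]
    [FiniteDimensional k K] : FiniteDimensional k L := by
  have h : FiniteDimensional k (normalClosure k K L) := inferInstance
  rw [normalClosure_eq_top] at h
  exact topEquiv.toLinearEquiv.finiteDimensional

theorem isGalois_of_isNormalClosure (K : IntermediateField k L) [IsNormalClosure k K L]
    [Algebra.IsSeparable k K] : IsGalois k L := by
  have : Normal k L := IsNormalClosure.normal (K := K)
  have : Algebra.IsSeparable k L := by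
    rw [← separableClosure.eq_top_iff, eq_top_iff, ← normalClosure_eq_top K, normalClosure_def]
    refine iSup_le fun f => ?_
    rintro _ ⟨y, rfl⟩
    rw [mem_separableClosure_iff]
    have := Algebra.IsSeparable.isSeparable k y
    rw [IsSeparable] at this ⊢
    change (minpoly k (f y)).Separable
    rwa [minpoly.algHom_eq f f.injective]
  exact ⟨⟩

/-- A normal subgroup fixing `K` fixes every conjugate of `K`, and these generate `L`. -/
theorem eq_bot_of_normal_of_le_fixingSubgroup (K : IntermediateField k L) [IsNormalClosure k K L]
    {W : Subgroup Gal(L/k)} (hW : W.Normal) (hle : W ≤ K.fixingSubgroup) : W = ⊥ := by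
  have : Normal k L := IsNormalClosure.normal (K := K)
  rw [eq_bot_iff, ← fixingSubgroup_top, ← normalClosure_eq_top K, ← le_iff_le, normalClosure_def'']
  refine iSup_le fun f => ?_
  rintro _ ⟨y, hy, rfl⟩ ⟨w, hw⟩
  have h1 := hle (hW.conj_mem w hw f⁻¹)
  rw [IntermediateField.mem_fixingSubgroup_iff] at h1
  have h2 := h1 y hy
  simp only [inv_inv, AlgEquiv.mul_apply] at h2
  have h3 := congrArg f h2
  change f (f.symm (w (f y))) = f y at h3
  rwa [AlgEquiv.apply_symm_apply] at h3

theorem card_fixingSubgroup_mul_finrank [FiniteDimensional k L] [IsGalois k L]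
    (F : IntermediateField k L) :
    Nat.card F.fixingSubgroup * Module.finrank k F = Nat.card Gal(L/k) := by
  rw [IsGalois.card_fixingSubgroup_eq_finrank, IsGalois.card_aut_eq_finrank, mul_comm,
    Module.finrank_mul_finrank]

theorem card_algHom_eq_finrank [FiniteDimensional k L] [IsGalois k L]
    (F : IntermediateField k L) : Fintype.card (F →ₐ[k] L) = Module.finrank k F := by
  rw [← Nat.card_eq_fintype_card]
  refine AlgHom.natCard_of_splits k F L fun x => ?_
  have := Normal.splits (F := k) (K := L) inferInstance (x : L)
  rwa [← minpoly.algebraMap_eq (algebraMap F L).injective]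

theorem exists_embAction_eq [Normal k L] (F : IntermediateField k L) (x : F →ₐ[k] L) :
    ∃ g : Gal(L/k), GreitherPareigis.embAction k F L g F.val = x := by
  let ψ : F ≃ₐ[k] x.fieldRange := AlgEquiv.ofInjectiveField x
  refine ⟨ψ.liftNormal L, ?_⟩
  ext a
  exact ψ.liftNormal_commutes L a

theorem embAction_val_eq_iff (F : IntermediateField k L) (g : Gal(L/k)) :
    GreitherPareigis.embAction k F L g F.val = F.val ↔ g ∈ F.fixingSubgroup := by
  rw [IntermediateField.mem_fixingSubgroup_iff]
  constructor
  · intro h x hx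
    exact congr($h ⟨x, hx⟩)
  · intro h
    ext x
    exact h x x.2

end Facts

/-! ### Subgroups of the dihedral group and characters of order two. -/

namespace TwoSFour

theorem sq_mem_of_card_eq_four {S : Subgroup TwoSFour} (hS : ∀ x ∈ S, x ∈ dihedral)
    (hcard : Nat.card S = 4) : sq ∈ S := by
  classical
  rw [Nat.card_eq_fintype_card] at hcard
  obtain ⟨x, hx⟩ := Fintype.exists_ne_of_one_lt_card (by omega) (1 : S)
  obtain ⟨y, hy1, hyx⟩ : ∃ y : S, y ≠ 1 ∧ y ≠ x := by
    by_contra! h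
    have : Finset.univ ⊆ ({1, x} : Finset S) := fun y _ => by
      by_cases hy : y = 1
      · simp [hy]
      · simp [h y hy]
    have := (Finset.card_le_card this).trans Finset.card_le_two
    rw [Finset.card_univ] at this
    omega
  rcases dihedral_pair x (hS _ x.2) y (hS _ y.2) (fun h => hx (Subtype.ext h))
    (fun h => hy1 (Subtype.ext h)) (fun h => hyx (Subtype.ext h.symm)) with
    h | h | h | h | h | h <;> rw [← h]
  · exact x.2
  · exact y.2
  · exact S.mul_mem x.2 x.2
  · exact S.mul_mem y.2 y.2
  · exact S.mul_mem x.2 y.2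
  · exact S.mul_mem (S.mul_mem x.2 y.2) (S.mul_mem x.2 y.2)

theorem sq_ne_one : sq ≠ 1 := by decide

theorem sq_mem : sq ∈ dihedral := by decide

theorem sq_mul_sq : sq * sq = 1 := by decide

section

variable {G : Type*} [Group G] (e : G ≃* TwoSFour) {H : Subgroup G}
  (hH : ∀ x, x ∈ H ↔ e x ∈ dihedral)

include hH

/-- A normal subgroup of order two is central, and the centre of the dihedral group of order eight
has order two. -/
theorem isNormalOrderTwo_iff (C : Subgroup G) :
    IsNormalOrderTwoSubgroup H C ↔ C = Subgroup.zpowers (e.symm sq) := by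
  constructor
  · rintro ⟨hle, hcard, hn⟩
    have hfin : Finite C := Nat.finite_of_card_ne_zero (by omega)
    obtain ⟨c, hc, hu⟩ : ∃ c : C, c ≠ 1 ∧ ∀ d : C, d ≠ 1 → d = c := by
      obtain ⟨a, b, hab, huniv⟩ := Nat.card_eq_two_iff.1 hcard
      have hall : ∀ d : C, d = a ∨ d = b := fun d => by
        have : d ∈ ({a, b} : Set C) := huniv ▸ Set.mem_univ d
        simpa using this
      rcases hall 1 with h | h
      · exact ⟨b, fun hb => hab (h.symm.trans hb.symm), fun d hd =>
          (hall d).resolve_left fun h' => hd (h'.trans h.symm)⟩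
      · exact ⟨a, fun ha => hab (ha.trans h), fun d hd =>
          (hall d).resolve_right fun h' => hd (h'.trans h.symm)⟩
    have hcentral : ∀ y ∈ H, y * c = c * y := by
      intro y hy
      have h1 := hn.conj_mem ⟨c, hle c.2⟩ (Subgroup.mem_subgroupOf.2 c.2) ⟨y, hy⟩
      have h2 : y * c * y⁻¹ ∈ C := h1
      have h3 := hu ⟨_, h2⟩ (fun h => hc (Subtype.ext (by
        have := congrArg Subtype.val h
        simpa [mul_inv_eq_one] using this)))
      exact mul_inv_eq_iff_eq_mul.1 (congrArg Subtype.val h3)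
    have hec : e c = sq := by
      refine eq_sq_of_central _ ((hH c).1 (hle c.2)) (fun h => hc (Subtype.ext ?_)) fun y hy => ?_
      · rwa [EmbeddingLike.map_eq_one_iff] at h
      · have := hcentral (e.symm y) ((hH _).2 (by simpa using hy))
        have := congrArg e this
        simpa using this
    have hcs : (c : G) = e.symm sq := by rw [← hec, e.symm_apply_apply]
    rw [← hcs]
    symm
    refine Subgroup.eq_of_le_of_card_ge (by simp) ?_
    rw [hcard, Nat.card_zpowers]
    have h1 : orderOf (c : G) = 2 := by
      rw [hcs, MulEquiv.orderOf_eq]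
      exact orderOf_eq_prime (by rw [pow_two, sq_mul_sq]) sq_ne_one
    exact h1.ge
  · rintro rfl
    have hs : e.symm sq ∈ H := (hH _).2 (by simpa using sq_mem)
    refine ⟨by simpa using hs, ?_, ?_⟩
    · rw [Nat.card_zpowers, MulEquiv.orderOf_eq]
      exact orderOf_eq_prime (by rw [pow_two, sq_mul_sq]) sq_ne_one
    · refine ⟨fun x hx y => ?_⟩
      rw [Subgroup.mem_subgroupOf] at hx ⊢
      have hcomm : Commute (y : G) (e.symm sq) := by
        apply e.injective
        have := sq_central _ ((hH y).1 y.2)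
        simpa using this
      obtain ⟨n, hn⟩ := hx
      have h1 : (y : G) * (x : G) * (y : G)⁻¹ = x := by
        rw [mul_inv_eq_iff_eq_mul]
        have := hcomm.zpow_right n
        simp only at hn
        rwa [hn] at this
      have h2 : ((y * x * y⁻¹ : H) : G) = x := h1
      rw [h2, ← hn]
      exact ⟨n, rfl⟩

end

set_option maxRecDepth 10000 in
theorem exists_not_commute : ∀ d : Equiv.Perm (Fin 4), d ≠ 1 →
    ∃ n : Equiv.Perm (Fin 4), n * d ≠ d * n := by decide

theorem dihedral_snd_ne_one : ∀ x ∈ dihedral, x ≠ 1 → x.2 ≠ 1 := by decide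

/-- A homomorphism from `2S₄` onto a group of order two other than the first projection, nontrivial
on `x` if the first projection is. -/
theorem exists_second_character (x : TwoSFour) (hx : x.1 = Multiplicative.ofAdd 1) :
    ∃ χ : TwoSFour →* Multiplicative (ZMod 2), χ x = Multiplicative.ofAdd 1 ∧
      χ (1, rot) = Multiplicative.ofAdd 1 := by
  let χ : TwoSFour →* Multiplicative (ZMod 2) :=
    signHom.comp (MonoidHom.snd (Multiplicative (ZMod 2)) (Equiv.Perm (Fin 4)))
  -- The sign itself serves if it is nontrivial on `x`; otherwise its product with the first
  -- projection does.
  rcases fst_eq_one_or (signHom x.2) with h | h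
  · refine ⟨MonoidHom.fst _ _ * χ, ?_, ?_⟩
    · simp [χ, h, hx]
    · simp [χ, signHom_rot]
  · exact ⟨χ, h, signHom_rot⟩

theorem mul_ofAdd_one_eq (c : Multiplicative (ZMod 2)) (hc : c ≠ 1) :
    c * Multiplicative.ofAdd 1 = 1 := by
  revert c; decide

end TwoSFour

namespace InvolutionComplement

variable {k : Type u} {L : Type v} [Field k] [Field L] [Algebra k L]
  {F : IntermediateField k L} {t : Gal(L/k)}

theorem two_mul_card (C : InvolutionComplement k L F t) :
    2 * Nat.card C.N = Nat.card Gal(L/k) := by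
  have : C.N.index = 2 := by
    rw [Subgroup.index_eq_two_iff]
    refine ⟨t, fun g => ?_⟩
    rcases C.mem_or g with h | h
    · exact Or.inr ⟨h, fun h' => C.notMem ((C.N.mul_mem_cancel_left h).1 h')⟩
    · exact Or.inl ⟨h, fun h' => C.notMem ((C.N.mul_mem_cancel_left h').1 h)⟩
  rw [← C.N.card_mul_index, this, mul_comm]

/-- The kernel of a character of order two that is nontrivial at `t` is a complement. -/
def ofCharacter (χ : Gal(L/k) →* Multiplicative (ZMod 2)) (hχ : χ t = Multiplicative.ofAdd 1)
    (mul_self : t * t = 1) (mem_fixing : ∀ g, g ∈ F.fixingSubgroup ↔ g = 1 ∨ g = t) :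
    InvolutionComplement k L F t where
  N := χ.ker
  normal := inferInstance
  notMem h := by
    rw [MonoidHom.mem_ker, hχ] at h
    exact absurd h (by decide)
  mem_or g := by
    by_cases h : χ g = 1
    · exact Or.inl h
    · exact Or.inr (by rw [MonoidHom.mem_ker, map_mul, hχ, TwoSFour.mul_ofAdd_one_eq _ h])
  mul_self := mul_self
  mem_fixing := mem_fixing

end InvolutionComplement

theorem Subgroup.exists_mem_iff_of_card_eq_two {G : Type*} [Group G] {S : Subgroup G}
    (hS : Nat.card S = 2) : ∃ t, t ≠ 1 ∧ t * t = 1 ∧ ∀ g, g ∈ S ↔ g = 1 ∨ g = t := by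
  have : Finite S := Nat.finite_of_card_ne_zero (by omega)
  obtain ⟨t, ht⟩ := exists_prime_orderOf_dvd_card' (G := S) 2 (by rw [hS])
  have hz : Subgroup.zpowers (t : G) = S := by
    refine Subgroup.eq_of_le_of_card_ge (by simp) ?_
    rw [hS, Nat.card_zpowers, Subgroup.orderOf_coe, ht]
  have h2 : (t : G) ^ 2 = 1 := by
    have := pow_orderOf_eq_one t
    rw [ht] at this
    exact congrArg Subtype.val this
  refine ⟨t, fun h => ?_, by rw [← pow_two, h2], fun g => ?_⟩
  · rw [show t = 1 from Subtype.ext h, orderOf_one] at ht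
    omega
  · constructor
    · intro hg
      rw [← hz] at hg
      obtain ⟨n, rfl⟩ := hg
      rcases Int.even_or_odd' n with ⟨m, rfl | rfl⟩
      · left
        change (t : G) ^ (2 * m) = 1
        rw [zpow_mul, zpow_ofNat, h2, one_zpow]
      · right
        change (t : G) ^ (2 * m + 1) = t
        rw [zpow_add, zpow_mul, zpow_ofNat, h2, one_zpow, one_mul, zpow_one]
    · rintro (rfl | rfl)
      · exact S.one_mem
      · exact t.2

/-! ### The intermediate fields of degrees 12 and 24. -/

section Main

variable {k : Type u} {L : Type v} [Field k] [Field L] [Algebra k L]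
  [FiniteDimensional k L] [IsGalois k L] {K : IntermediateField k L}
  (e : Gal(L/k) ≃* TwoSFour) (he : ∀ g, g ∈ K.fixingSubgroup ↔ e g ∈ TwoSFour.dihedral)

include e in
theorem card_gal_eq : Nat.card Gal(L/k) = 48 := by
  rw [Nat.card_congr e.toEquiv, Nat.card_eq_fintype_card, Fintype.card_prod, Fintype.card_perm]
  rfl

include he

theorem not_isHopfGalois_of_finrank_eq_twelve {F : IntermediateField k L} (hKF : K ≤ F)
    (hF : Module.finrank k F = 12) : ¬ IsHopfGalois k F := by
  rintro ⟨S⟩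
  have hcard := card_fixingSubgroup_mul_finrank F
  rw [card_gal_eq e, hF] at hcard
  have hX := card_algHom_eq_finrank F
  obtain ⟨N, hN, hnorm⟩ := GreitherPareigis.exists_regular_normalized hX S
  let U : Subgroup TwoSFour := F.fixingSubgroup.comap e.symm.toMonoidHom
  have hU : ∀ x, x ∈ U ↔ e.symm x ∈ F.fixingSubgroup := fun x => Iff.rfl
  have hUd : ∀ x ∈ U, x ∈ TwoSFour.dihedral := fun x hx => by
    have := (he _).1 (IntermediateField.fixingSubgroup_le hKF ((hU x).1 hx))
    rwa [e.apply_symm_apply] at this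
  have hU4 : Nat.card U = 4 := by
    have : Nat.card U = Nat.card F.fixingSubgroup :=
      Nat.card_congr (e.symm.toEquiv.subtypeEquiv fun x => Iff.rfl)
    omega
  let lam : TwoSFour →* Equiv.Perm (F →ₐ[k] L) :=
    (GreitherPareigis.embAction k F L).comp e.symm.toMonoidHom
  refine TwoSFour.not_normalized_regular hUd (TwoSFour.sq_mem_of_card_eq_four hUd hU4) lam F.val
    (fun g => embAction_val_eq_iff F _) (fun x => ?_) hN (fun g n hn => hnorm _ n hn)
    (hX.trans hF)
  obtain ⟨g, hg⟩ := exists_embAction_eq F x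
  refine ⟨e g, ?_⟩
  change GreitherPareigis.embAction k F L (e.symm (e g)) F.val = x
  rw [e.symm_apply_apply, hg]

theorem isAlmostClassicallyGalois_and_exists {F : IntermediateField k L} (hKF : K ≤ F)
    (hF : Module.finrank k F = 24)
    (hne : F ≠ IntermediateField.fixedField (Subgroup.zpowers (e.symm TwoSFour.sq))) :
    IsAlmostClassicallyGalois k F ∧ ∃ S T : HopfGaloisStructure k F, ¬ S.Equivalent T := by
  have hcard := card_fixingSubgroup_mul_finrank F
  rw [card_gal_eq e, hF] at hcard
  obtain ⟨t, ht1, htt, ht⟩ := Subgroup.exists_mem_iff_of_card_eq_two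
    (show Nat.card F.fixingSubgroup = 2 by omega)
  have htF : t ∈ F.fixingSubgroup := (ht t).2 (Or.inr rfl)
  have htd : e t ∈ TwoSFour.dihedral := (he t).1 (IntermediateField.fixingSubgroup_le hKF htF)
  have het1 : e t ≠ 1 := fun h => ht1 (by rwa [EmbeddingLike.map_eq_one_iff] at h)
  have hts : e t ≠ TwoSFour.sq := by
    intro h
    refine hne ?_
    rw [← h, e.symm_apply_apply, ← IsGalois.fixedField_fixingSubgroup F]
    congr 1
    symm
    refine Subgroup.eq_of_le_of_card_ge (by simpa using htF) ?_
    rw [Nat.card_zpowers, orderOf_eq_prime (by rw [pow_two, htt]) ht1]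
    omega
  have hfst := TwoSFour.dihedral_involution _ htd het1 (by rw [← map_mul, htt, map_one]) hts
  obtain ⟨χ, hχt, hχr⟩ := TwoSFour.exists_second_character _ hfst
  let C₁ : InvolutionComplement k L F t := .ofCharacter
    ((MonoidHom.fst (Multiplicative (ZMod 2)) (Equiv.Perm (Fin 4))).comp e.toMonoidHom) hfst htt ht
  let C₂ : InvolutionComplement k L F t := .ofCharacter (χ.comp e.toMonoidHom) hχt htt ht
  have h1 : ∀ g, g ∈ C₁.N ↔ (e g).1 = 1 := fun g => Iff.rfl
  have h2 : ∀ g, g ∈ C₂.N ↔ χ (e g) = 1 := fun g => Iff.rfl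
  have hC : C₁.N ≠ C₂.N := by
    intro h
    have h3 : e.symm (1, TwoSFour.rot) ∈ C₁.N := by rw [h1, e.apply_symm_apply]
    rw [h, h2, e.apply_symm_apply, hχr] at h3
    exact absurd h3 (by decide)
  have hfin : ∀ C : InvolutionComplement k L F t, Module.finrank k F = Nat.card C.N := fun C => by
    have := C.two_mul_card
    rw [card_gal_eq e] at this
    omega
  -- `(1, n)` lies in the kernel of the first projection and does not commute with `t`, as
  -- `not_equivalent` requires.
  obtain ⟨n, hn⟩ := TwoSFour.exists_not_commute _ (TwoSFour.dihedral_snd_ne_one _ htd het1)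
  refine ⟨C₁.isAlmostClassicallyGalois, C₁.hopfGaloisStructure (hfin C₁),
    C₂.hopfGaloisStructure (hfin C₂), C₁.not_equivalent C₂ hC (hfin C₁) (hfin C₂)
      (n := e.symm (1, n)) ?_ ?_⟩
  · rw [h1, e.apply_symm_apply]
  · intro h
    have := congrArg (fun g => (e g).2) h
    simp only [map_mul, e.apply_symm_apply, Prod.snd_mul] at this
    exact hn this

theorem exists_finrank_eq_twentyFour : ∃ F : IntermediateField k L, K ≤ F ∧
    Module.finrank k F = 24 ∧
      F ≠ IntermediateField.fixedField (Subgroup.zpowers (e.symm TwoSFour.sq)) := by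
  -- A reflection: its first coordinate is nontrivial, whereas that of every power of `sq` is
  -- trivial.
  let t : Gal(L/k) := e.symm (Multiplicative.ofAdd 1, TwoSFour.flip)
  have het : e t = (Multiplicative.ofAdd 1, TwoSFour.flip) := e.apply_symm_apply _
  have htK : t ∈ K.fixingSubgroup := by rw [he, het]; decide
  have hord : orderOf t = 2 := by
    rw [← MulEquiv.orderOf_eq e, het]
    exact orderOf_eq_prime (by decide) (by decide)
  have hfix := IntermediateField.fixingSubgroup_fixedField (Subgroup.zpowers t)
  refine ⟨IntermediateField.fixedField (Subgroup.zpowers t), ?_, ?_, ?_⟩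
  · rw [IntermediateField.le_iff_le]
    simpa using htK
  · have := card_fixingSubgroup_mul_finrank (IntermediateField.fixedField (Subgroup.zpowers t))
    rw [hfix, Nat.card_zpowers, hord, card_gal_eq e] at this
    omega
  · intro h
    have h1 := congrArg IntermediateField.fixingSubgroup h
    rw [hfix, IntermediateField.fixingSubgroup_fixedField] at h1
    have h2 : t ∈ Subgroup.zpowers (e.symm TwoSFour.sq) := h1 ▸ Subgroup.mem_zpowers t
    obtain ⟨n, hn⟩ := h2
    have h3 := congrArg (fun g => MonoidHom.fst (Multiplicative (ZMod 2)) (Equiv.Perm (Fin 4)) (e g)) hn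
    simp only [map_zpow, e.apply_symm_apply, het] at h3
    rw [show MonoidHom.fst (Multiplicative (ZMod 2)) (Equiv.Perm (Fin 4)) TwoSFour.sq = 1 from rfl,
      one_zpow] at h3
    exact absurd h3 (by decide)

end Main

theorem mainTheorem9 {k : Type u} {L : Type v} [Field k] [Field L] [Algebra k L]
    (K : IntermediateField k L) [Algebra.IsSeparable k K] (hdeg : Module.finrank k K = 6)
    [IsNormalClosure k K L] (hGal : Nonempty (Gal(L/k) ≃* TwoSFour)) :
    (∀ F : IntermediateField k L, K ≤ F → Module.finrank k F = 12 → ¬ IsHopfGalois k F) ∧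
    (∃ F : IntermediateField k L,
      K ≤ F ∧ Module.finrank k F = 24 ∧ IsAlmostClassicallyGalois k F) ∧
    (∃! C : Subgroup Gal(L/k), IsNormalOrderTwoSubgroup K.fixingSubgroup C) ∧
    (∀ C : Subgroup Gal(L/k), IsNormalOrderTwoSubgroup K.fixingSubgroup C →
      ∀ F : IntermediateField k L, K ≤ F → Module.finrank k F = 24 →
        F ≠ IntermediateField.fixedField C →
          IsAlmostClassicallyGalois k F ∧
          ∃ S T : HopfGaloisStructure k F, ¬ S.Equivalent T) := by
  have : FiniteDimensional k K := FiniteDimensional.of_finrank_pos (by omega)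
  have : FiniteDimensional k L := finiteDimensional_of_isNormalClosure K
  have : IsGalois k L := isGalois_of_isNormalClosure K
  obtain ⟨e₀⟩ := hGal
  have hcard := card_fixingSubgroup_mul_finrank K
  rw [card_gal_eq e₀, hdeg] at hcard
  let H : Subgroup TwoSFour := K.fixingSubgroup.comap e₀.symm.toMonoidHom
  have hH : ∀ x, x ∈ H ↔ e₀.symm x ∈ K.fixingSubgroup := fun x => Iff.rfl
  have hH8 : Nat.card H = 8 := by
    have : Nat.card H = Nat.card K.fixingSubgroup :=
      Nat.card_congr (e₀.symm.toEquiv.subtypeEquiv fun x => Iff.rfl)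
    omega
  obtain ⟨e₁, he₁⟩ := TwoSFour.exists_equiv_dihedral hH8 fun W hW hle => by
    have h1 : W.comap e₀.toMonoidHom = ⊥ :=
      eq_bot_of_normal_of_le_fixingSubgroup K (hW.comap _) fun g hg => by
        have := (hH _).1 (hle hg)
        rwa [MulEquiv.coe_toMonoidHom, e₀.symm_apply_apply] at this
    rw [eq_bot_iff]
    intro w hw
    have h2 : e₀.symm w ∈ W.comap e₀.toMonoidHom := by
      rw [Subgroup.mem_comap, MulEquiv.coe_toMonoidHom, e₀.apply_symm_apply]
      exact hw
    rw [h1, Subgroup.mem_bot, EmbeddingLike.map_eq_one_iff] at h2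
    exact h2
  let e : Gal(L/k) ≃* TwoSFour := e₀.trans e₁
  have he : ∀ g, g ∈ K.fixingSubgroup ↔ e g ∈ TwoSFour.dihedral := fun g => by
    rw [MulEquiv.trans_apply, ← he₁, hH, e₀.symm_apply_apply]
  refine ⟨fun F hKF hF => not_isHopfGalois_of_finrank_eq_twelve e he hKF hF, ?_, ?_, ?_⟩
  · obtain ⟨F, hKF, hF, hne⟩ := exists_finrank_eq_twentyFour e he
    exact ⟨F, hKF, hF, (isAlmostClassicallyGalois_and_exists e he hKF hF hne).1⟩
  · exact ⟨_, (TwoSFour.isNormalOrderTwo_iff e he _).2 rfl,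
      fun C hC => (TwoSFour.isNormalOrderTwo_iff e he C).1 hC⟩
  · intro C hC F hKF hF hne
    rw [(TwoSFour.isNormalOrderTwo_iff e he C).1 hC] at hne
    exact isAlmostClassicallyGalois_and_exists e he hKF hF hne
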